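/- **Setting.** Points of $\mathbb R^{1+2}$ are $(t,x)=(x^0,x^1,x^2)$, $r=|x|$, $\partial_\alpha=\partial_{x^\alpha}$, $\eta=\mathrm{diag}(-1,1,1)$, $\Box=-\partial_t^2+\partial_1^2+\partial_2^2$. Let $\gamma^0,\gamma^1,\gamma^2$ be complex $2\times2$ matrices with $\gamma^\mu\gamma^\nu+\gamma^\nu\gamma^\mu=-2\eta^{\mu\nu}I_2$, $(\gamma^0)^*=\gamma^0$ and $(\gamma^a)^*=-\gamma^a$ for $a=1,2$. Put $L_a=t\partial_a+x_a\partial_t$ and $\widehat L_a=L_a-\tfrac12\gamma^0\gamma^a$ ($a=1,2$). For multi-indices, i.e. finite sequences $I=(\alpha_1,\dots,\alpha_m)$ in $\{0,1,2\}$ and $J=(a_1,\dots,a_k)$ in $\{1,2\}$, put $\partial^I=\partial_{\alpha_1}\cdots\partial_{\alpha_m}$, $L^J=L_{a_1}\cdots L_{a_k}$, $\widehat L^J=\widehat L_{a_1}\cdots\widehat L_{a_k}$, $|I|=m$, $|J|=k$. For $s\ge 2$ let $\mathcal H_s=\{t>0,\ t^2=|x|^2+s^2\}$, let $\mathcal K=\{t\ge2,\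 t\ge|x|+1\}$, and let $\|\phi\|_{L^2_f(\mathcal H_s)}^2=\int_{\mathbb R^2}|\phi(\sqrt{s^2+|x|^2},x)|^2\,dx$. Integrals over $\mathcal H_s$ are taken with respect to $dx$ in the same way, and $$\mathcal E_1(s,\phi)=\int_{\mathcal H_s}\Big(\sum_\alpha|\partial_\alpha\phi|^2+2\tfrac{x^a}{t}\partial_t\phi\,\partial_a\phi+\phi^2\Big)dx,\qquad \mathcal E^D(s,\Psi)=\int_{\mathcal H_s}\Big(\Psi^*\Psi-\tfrac{x^a}{t}\Psi^*\gamma^0\gamma^a\Psi\Big)dx$$ (for real-valued $\phi$ and $\mathbb C^2$-valued $\Psi$, summing over $a=1,2$). **Statement.** For every integer $N\ge4$ there is a constant $C>0$ such that the following holds. Let $\gamma^\mu$ be as above, $0<\delta\le\tfrac1{10}$, $C_1,\varepsilon>0$ with $C_1\varepsilon\le1$, and $2<s_1\le\infty$. Let $\psi$ ($\mathbb C^2$-valued, of class $C^N$) and $v$ (real-valued, of class $C^{N+1}$), defined on a neighbourhood of $\bigcup_{2\le s<s_1}\mathcal H_s$, solve on $\bigcup_{2\le s<s_1}\mathcal H_s$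 the system $$i\gamma^\mu\partial_\mu\psi=v\psi,\qquad -\Box v+v=\psi^*\gamma^0\psi,$$ and vanish at the points of this set outside $\mathcal K$. Assume the bootstrap bounds for all $s\in[2,s_1)$: $$\mathcal E^D(s,\partial^I\widehat L^J\psi)^{1/2}\le C_1\varepsilon,\quad \mathcal E_1(s,\partial^IL^Jv)^{1/2}\le C_1\varepsilon\qquad(|I|+|J|\le N-1),$$ $$\mathcal E^D(s,\partial^I\widehat L^J\psi)^{1/2}\le C_1\varepsilon s^\delta,\quad \mathcal E_1(s,\partial^IL^Jv)^{1/2}\le C_1\varepsilon s^\delta\qquad(|I|+|J|\le N).$$ Then for all $s\in[2,s_1)$ and all $\alpha\in\{0,1,2\}$: $$\big\|(t-r)(s/t)\,\partial_\alpha\partial^IL^J\psi\big\|_{L^2_f(\mathcal H_s)}+\big\|(t-r)(s/t)\,\partial_\alpha\partial^I\widehat L^J\psi\big\|_{L^2_f(\mathcal H_s)}\le C\,C_1\varepsilon\,s^\delta\qquad(|I|+|J|\le N-1),$$ and at every point of $\mathcal H_s$ $$\big|\partial_\alpha\partial^IL^J\psi\big|+\big|\partial_\alpha\partial^I\widehat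 L^J\psi\big|\le C\,C_1\varepsilon\,(t-r)^{-1}s^{-1+\delta}\qquad(|I|+|J|\le N-3).$$ -/

import Mathlib

open MeasureTheory
open scoped ENNReal Matrix

noncomputable section

/-- The space `ℝ²` with its Euclidean norm and Lebesgue measure. -/
abbrev Space2 := EuclideanSpace ℝ (Fin 2)

/-- Points `(t, x)` of `ℝ^{1+2}`. -/
abbrev Spacetime := ℝ × Space2

/-- The spinor space `ℂ²` with its Hermitian norm. -/
abbrev Spinor := EuclideanSpace ℂ (Fin 2)

/-- The Minkowski metric `diag(-1, 1, 1)`. -/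
def minkowski (μ ν : Fin 3) : ℂ :=
  if μ = ν then (if μ = 0 then -1 else 1) else 0

/-- `γ⁰, γ¹, γ²` are Dirac matrices: the Clifford relations
`γ^μ γ^ν + γ^ν γ^μ = -2 η^{μν} I₂` and the relations `(γ^μ)^* = -η^μ_ν γ^ν`
(so `γ⁰` is Hermitian and `γ¹, γ²` are anti-Hermitian). -/
structure IsDiracMatrices (γ : Fin 3 → Matrix (Fin 2) (Fin 2) ℂ) : Prop where
  clifford : ∀ μ ν, γ μ * γ ν + γ ν * γ μ = (-2 * minkowski μ ν) • (1 : Matrix (Fin 2) (Fin 2) ℂ)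
  adjoint : ∀ μ, (γ μ)ᴴ = -∑ ν, minkowski μ ν • γ ν

/-- A `2 × 2` matrix acting on a spinor. -/
def matAct (A : Matrix (Fin 2) (Fin 2) ℂ) (w : Spinor) : Spinor :=
  WithLp.toLp 2 (A *ᵥ w.ofLp)

/-- The sesquilinear expression `w^* A z`. -/
def sesq (w : Spinor) (A : Matrix (Fin 2) (Fin 2) ℂ) (z : Spinor) : ℂ :=
  star w.ofLp ⬝ᵥ (A *ᵥ z.ofLp)

/-- The coordinate direction `e_α` of `ℝ^{1+2}`; `α = 0` is the time direction. -/
def coordDir (α : Fin 3) : Spacetime :=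
  Fin.cases (1, 0) (fun a => (0, EuclideanSpace.single a 1)) α

/-- The partial derivative `∂_α φ`. Spacetime indices are `α : Fin 3`, spatial indices are
`a : Fin 2`; the spacetime index of the spatial index `a` is `a.succ`. -/
def pd {E : Type*} [NormedAddCommGroup E] [NormedSpace ℝ E] (α : Fin 3)
    (φ : Spacetime → E) : Spacetime → E :=
  fun p => fderiv ℝ φ p (coordDir α)

/-- The Lorentz boost `L_a φ = t ∂_a φ + x_a ∂_t φ`. -/
def boost {E : Type*} [NormedAddCommGroup E] [NormedSpace ℝ E] (a : Fin 2)
    (φ : Spacetime → E) : Spacetime → E :=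
  fun p => p.1 • pd a.succ φ p + p.2 a • pd 0 φ p

/-- The modified boost `L̂_a Ψ = L_a Ψ - (1/2) γ⁰ γ^a Ψ`. -/
def modBoost (γ : Fin 3 → Matrix (Fin 2) (Fin 2) ℂ) (a : Fin 2)
    (Ψ : Spacetime → Spinor) : Spacetime → Spinor :=
  fun p => boost a Ψ p - (1 / 2 : ℝ) • matAct (γ 0 * γ a.succ) (Ψ p)

/-- `∂^I φ = ∂_{α₁} ⋯ ∂_{α_m} φ` for `I = [α₁, …, α_m]`, with `|I| = m`. -/
def pdIter {E : Type*} [NormedAddCommGroup E] [NormedSpace ℝ E] (I : List (Fin 3))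
    (φ : Spacetime → E) : Spacetime → E :=
  I.foldr pd φ

/-- `L^J φ = L_{a₁} ⋯ L_{a_m} φ`. -/
def boostIter {E : Type*} [NormedAddCommGroup E] [NormedSpace ℝ E] (J : List (Fin 2))
    (φ : Spacetime → E) : Spacetime → E :=
  J.foldr boost φ

/-- `L̂^J Ψ = L̂_{a₁} ⋯ L̂_{a_m} Ψ`. -/
def modBoostIter (γ : Fin 3 → Matrix (Fin 2) (Fin 2) ℂ) (J : List (Fin 2))
    (Ψ : Spacetime → Spinor) : Spacetime → Spinor :=
  J.foldr (modBoost γ) Ψ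

/-- The wave operator `□ = -∂_t∂_t + ∂_1∂_1 + ∂_2∂_2`. -/
def waveOp (v : Spacetime → ℝ) (p : Spacetime) : ℝ :=
  -pd 0 (pd 0 v) p + ∑ a : Fin 2, pd a.succ (pd a.succ v) p

/-- The Dirac operator `i γ^μ ∂_μ`. -/
def diracOp (γ : Fin 3 → Matrix (Fin 2) (Fin 2) ℂ) (Ψ : Spacetime → Spinor) (p : Spacetime) :
    Spinor :=
  Complex.I • ∑ μ : Fin 3, matAct (γ μ) (pd μ Ψ p)

/-- The point of the hyperboloid `H_s = {t² = |x|² + s², t > 0}` lying above `x ∈ ℝ²`. -/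
def hypPt (s : ℝ) (x : Space2) : Spacetime :=
  (Real.sqrt (s ^ 2 + ‖x‖ ^ 2), x)

/-- The region `⋃_{2 ≤ s < s₁} H_s`; here `s₁ = ∞` is allowed. -/
def hypRegion (s₁ : EReal) : Set Spacetime :=
  {p | ∃ (s : ℝ) (x : Space2), 2 ≤ s ∧ (s : EReal) < s₁ ∧ p = hypPt s x}

/-- The truncated light cone `K = {t ≥ 2, t ≥ |x| + 1}`. -/
def coneK : Set Spacetime :=
  {p | 2 ≤ p.1 ∧ ‖p.2‖ + 1 ≤ p.1}

/-- The energy on `H_s` of a real field of mass `m`, with respect to `dx`: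
`∫ ∑_α |∂_α φ|² + 2 (x^a/t) ∂_t φ ∂_a φ + m² |φ|² dx`. -/
def energyKG (m s : ℝ) (φ : Spacetime → ℝ) : ℝ :=
  ∫ x : Space2,
    ((∑ α : Fin 3, pd α φ (hypPt s x) ^ 2)
      + (∑ a : Fin 2, x a / (hypPt s x).1 *
          (2 * (pd 0 φ (hypPt s x) * pd a.succ φ (hypPt s x))))
      + m ^ 2 * φ (hypPt s x) ^ 2)

/-- The Dirac energy on `H_s`: `∫ Ψ^* Ψ - (x^a/t) Ψ^* γ⁰ γ^a Ψ dx`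
(the integrand is real, since `γ⁰ γ^a` is Hermitian). -/
def energyDirac (γ : Fin 3 → Matrix (Fin 2) (Fin 2) ℂ) (s : ℝ) (Ψ : Spacetime → Spinor) : ℝ :=
  ∫ x : Space2,
    (‖Ψ (hypPt s x)‖ ^ 2
      - ∑ a : Fin 2, x a / (hypPt s x).1 *
          (sesq (Ψ (hypPt s x)) (γ 0 * γ a.succ) (Ψ (hypPt s x))).re)

/-- The norm of `L²_f(H_s)`, i.e. the `L²` norm on `H_s` with respect to the flat measure `dx`. -/
def normL2f {E : Type*} [NormedAddCommGroup E] (s : ℝ) (φ : Spacetime → E) : ℝ≥0∞ :=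
  eLpNorm (fun x : Space2 => φ (hypPt s x)) 2 volume

/-- `(ψ, v)` is a (classical) solution of the massless-Dirac--Klein--Gordon system
`i γ^μ ∂_μ ψ = v ψ`, `-□ v + v = ψ^* γ⁰ ψ` on `⋃_{2 ≤ s < s₁} H_s`, supported in `K`, for which
`∂^I L̂^J ψ` and `∂ ∂^I L^J v` exist and are continuous for `|I| + |J| ≤ N`. -/
structure IsDKGSolution (γ : Fin 3 → Matrix (Fin 2) (Fin 2) ℂ) (N : ℕ) (s₁ : EReal)
    (ψ : Spacetime → Spinor) (v : Spacetime → ℝ) : Prop where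
  regular : ∃ U : Set Spacetime, IsOpen U ∧ hypRegion s₁ ⊆ U ∧
    ContDiffOn ℝ (N : WithTop ℕ∞) ψ U ∧ ContDiffOn ℝ ((N + 1 : ℕ) : WithTop ℕ∞) v U
  dirac : ∀ p ∈ hypRegion s₁, diracOp γ ψ p = v p • ψ p
  kleinGordon : ∀ p ∈ hypRegion s₁, ((-waveOp v p + v p : ℝ) : ℂ) = sesq (ψ p) (γ 0) (ψ p)
  support : ∀ p ∈ hypRegion s₁, p ∉ coneK → ψ p = 0 ∧ v p = 0

/-- The bootstrap bounds on `[2, s₁)`. -/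
structure BootstrapBounds (γ : Fin 3 → Matrix (Fin 2) (Fin 2) ℂ) (N : ℕ) (s₁ : EReal)
    (C₁ ε δ : ℝ) (ψ : Spacetime → Spinor) (v : Spacetime → ℝ) : Prop where
  dirac_low : ∀ s : ℝ, 2 ≤ s → (s : EReal) < s₁ → ∀ (I : List (Fin 3)) (J : List (Fin 2)),
    I.length + J.length + 1 ≤ N →
      Real.sqrt (energyDirac γ s (pdIter I (modBoostIter γ J ψ))) ≤ C₁ * ε
  dirac_top : ∀ s : ℝ, 2 ≤ s → (s : EReal) < s₁ → ∀ (I : List (Fin 3)) (J : List (Fin 2)),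
    I.length + J.length ≤ N →
      Real.sqrt (energyDirac γ s (pdIter I (modBoostIter γ J ψ))) ≤ C₁ * ε * s ^ δ
  kg_low : ∀ s : ℝ, 2 ≤ s → (s : EReal) < s₁ → ∀ (I : List (Fin 3)) (J : List (Fin 2)),
    I.length + J.length + 1 ≤ N →
      Real.sqrt (energyKG 1 s (pdIter I (boostIter J v))) ≤ C₁ * ε
  kg_top : ∀ s : ℝ, 2 ≤ s → (s : EReal) < s₁ → ∀ (I : List (Fin 3)) (J : List (Fin 2)),
    I.length + J.length ≤ N →
      Real.sqrt (energyKG 1 s (pdIter I (boostIter J v))) ≤ C₁ * ε * s ^ δ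

/-- The weight `(t - r)(s/t)` at a point `(t, x)` of `H_s`, with `r = |x|`. -/
def coneWeight (s : ℝ) (p : Spacetime) : ℝ :=
  (p.1 - ‖p.2‖) * (s / p.1)

end

/-! The heart is a pointwise algebraic identity. For a spinor `Φ` substitute `t∂_aΦ = L_aΦ -
x_a∂_tΦ` into `t · iγ^μ∂_μΦ`. This gives `(tγ⁰ - x_aγ^a)∂_tΦ = -it(iγ^μ∂_μΦ) - γ^aL_aΦ`, and the
matrix on the left squares to `t² - r²` with norm `O(t)`. Hence `(t - r)|∂Φ| ≲ |LΦ| + t|iγ^μ∂_μΦ|`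
(`coneDist_mul_norm_pd_le`). Multiplied by `s/t`, the right side becomes `(s/t)|LΦ| + s|iγ^μ∂_μΦ|`.

Take `Φ = ∂^I L̂^J ψ`. The first term is one boost more, hence bounded by the top-order Dirac
energy, which controls the `L²` norm of `(s/t)Ψ` (`energyDirac_density_ge`); this is the source of
`s^δ`. For the second, `L̂_a` and `∂_α` commute with the Dirac operator (`opBoost_diracOp`), so
`iγ^μ∂_μΦ = ∂^I L̂^J(vψ)`, a sum of products of derivatives of `v` and `ψ`.

The products are estimated by a Klainerman-Sobolev inequality on hyperboloids
(`norm_le_of_L2Le_boost`): derivatives of `v` decay like `t⁻¹` and those of `ψ` like `s⁻¹`, up to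
order `N - 3`. In `L²` the factor with few derivatives goes in `L^∞`, the other in `L²`
(`HyperboloidBounds.l2Le_product`). In the pointwise bound both go in `L^∞`, and the boost term uses
Klainerman-Sobolev with the top-order energy, giving `s^(-1+δ)`.

The predicates `Gen` and `PGen` record that a function is a combination of normal-form derivatives
`∂^I L̂^J`, or of products of them, with an explicit constant. They take care of all commutators and
of the passage from `L̂^J` to `L^J`. -/

noncomputable section

/-! ### Calculus of translations and boosts on spacetime. -/

section Calculus

variable {E : Type*} [NormedAddCommGroup E] [NormedSpace ℝ E]
  {U : Set Spacetime} {φ φ' : Spacetime → E} {p : Spacetime}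

theorem ContDiffOn.differentiableAt_of_isOpen {n : ℕ} (hU : IsOpen U)
    (h : ContDiffOn ℝ ((n + 1 : ℕ) : WithTop ℕ∞) φ U) (hp : p ∈ U) : DifferentiableAt ℝ φ p :=
  (h.contDiffAt (hU.mem_nhds hp)).differentiableAt (by simp)

theorem ContDiffOn.pd {n : ℕ} (hU : IsOpen U)
    (h : ContDiffOn ℝ ((n + 1 : ℕ) : WithTop ℕ∞) φ U) (α : Fin 3) :
    ContDiffOn ℝ (n : WithTop ℕ∞) (pd α φ) U :=
  (h.fderiv_of_isOpen hU (by norm_cast)).clm_apply contDiffOn_const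

theorem contDiff_coord (a : Fin 2) {n : WithTop ℕ∞} :
    ContDiff ℝ n (fun p : Spacetime => p.2 a) := by
  fun_prop

theorem ContDiffOn.boost {n : ℕ} (hU : IsOpen U)
    (h : ContDiffOn ℝ ((n + 1 : ℕ) : WithTop ℕ∞) φ U) (a : Fin 2) :
    ContDiffOn ℝ (n : WithTop ℕ∞) (boost a φ) U :=
  (contDiff_fst.contDiffOn.smul (h.pd hU a.succ)).add
    ((contDiff_coord a).contDiffOn.smul (h.pd hU 0))

theorem Set.EqOn.pd (hU : IsOpen U) (h : Set.EqOn φ φ' U) (α : Fin 3) :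
    Set.EqOn (pd α φ) (pd α φ') U := by
  intro p hp
  have : φ =ᶠ[nhds p] φ' := Filter.eventuallyEq_of_mem (hU.mem_nhds hp) h
  simp only [_root_.pd, this.fderiv_eq]

theorem Set.EqOn.boost (hU : IsOpen U) (h : Set.EqOn φ φ' U) (a : Fin 2) :
    Set.EqOn (boost a φ) (boost a φ') U := by
  intro p hp
  simp only [_root_.boost, h.pd hU _ hp]

theorem pd_comm (hU : IsOpen U) (h : ContDiffOn ℝ ((2 : ℕ) : WithTop ℕ∞) φ U) (hp : p ∈ U)
    (α β : Fin 3) : pd α (pd β φ) p = pd β (pd α φ) p := by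
  have hd : DifferentiableAt ℝ (fderiv ℝ φ) p :=
    ((h.fderiv_of_isOpen hU (m := 1) (by norm_cast)).contDiffAt
      (hU.mem_nhds hp)).differentiableAt (by simp)
  have key (α β : Fin 3) : pd α (pd β φ) p = fderiv ℝ (fderiv ℝ φ) p (coordDir α) (coordDir β) := by
    change fderiv ℝ (fun q => fderiv ℝ φ q (coordDir β)) p (coordDir α) = _
    rw [fderiv_clm_apply hd (by fun_prop)]
    simp
  rw [key, key]
  have hs : IsSymmSndFDerivAt ℝ φ p :=
    (h.contDiffAt (hU.mem_nhds hp)).isSymmSndFDerivAt (by simp)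
  exact hs.eq _ _

theorem pd_add {f g : Spacetime → E} (hf : DifferentiableAt ℝ f p) (hg : DifferentiableAt ℝ g p)
    (α : Fin 3) : pd α (fun q => f q + g q) p = pd α f p + pd α g p := by
  simp [pd, fderiv_fun_add hf hg]

theorem pd_smul {v : Spacetime → ℝ} {f : Spacetime → E} (hv : DifferentiableAt ℝ v p)
    (hf : DifferentiableAt ℝ f p) (α : Fin 3) :
    pd α (fun q => v q • f q) p = pd α v p • f p + v p • pd α f p := by
  simp [pd, fderiv_fun_smul hv hf, add_comm]

theorem pd_clm {F : Type*} [NormedAddCommGroup F] [NormedSpace ℝ F] (A : E →L[ℝ] F)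
    {f : Spacetime → E} (hf : DifferentiableAt ℝ f p) (α : Fin 3) :
    pd α (fun q => A (f q)) p = A (pd α f p) := by
  have := A.hasFDerivAt.comp p hf.hasFDerivAt
  simp only [pd]
  rw [show (fun q => A (f q)) = A ∘ f from rfl, this.fderiv]
  rfl

theorem boost_add {f g : Spacetime → E} (hf : DifferentiableAt ℝ f p)
    (hg : DifferentiableAt ℝ g p) (a : Fin 2) :
    boost a (fun q => f q + g q) p = boost a f p + boost a g p := by
  simp only [boost, pd_add hf hg, smul_add]
  abel

theorem boost_smul {v : Spacetime → ℝ} {f : Spacetime → E} (hv : DifferentiableAt ℝ v p)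
    (hf : DifferentiableAt ℝ f p) (a : Fin 2) :
    boost a (fun q => v q • f q) p = boost a v p • f p + v p • boost a f p := by
  simp only [boost, pd_smul hv hf, smul_add, add_smul, smul_smul, smul_eq_mul]
  simp only [mul_comm (v p)]
  abel

theorem boost_clm {F : Type*} [NormedAddCommGroup F] [NormedSpace ℝ F] (A : E →L[ℝ] F)
    {f : Spacetime → E} (hf : DifferentiableAt ℝ f p) (a : Fin 2) :
    boost a (fun q => A (f q)) p = A (boost a f p) := by
  simp only [boost, pd_clm A hf, map_add, map_smul]

theorem pd_fst (α : Fin 3) (p : Spacetime) : pd α (fun q => q.1) p = (coordDir α).1 := by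
  simp [pd, fderiv_fst]

theorem pd_coord (α : Fin 3) (a : Fin 2) (p : Spacetime) :
    pd α (fun q => q.2 a) p = (coordDir α).2 a := by
  have : HasFDerivAt (fun q : Spacetime => q.2 a)
      ((EuclideanSpace.proj a : Space2 →L[ℝ] ℝ).comp (ContinuousLinearMap.snd ℝ ℝ Space2)) p :=
    ((EuclideanSpace.proj a : Space2 →L[ℝ] ℝ).comp
      (ContinuousLinearMap.snd ℝ ℝ Space2)).hasFDerivAt
  simp [pd, this.fderiv]

/-- The commutator of a boost with a translation. -/
theorem pd_boost (hU : IsOpen U) (h : ContDiffOn ℝ ((2 : ℕ) : WithTop ℕ∞) φ U) (hp : p ∈ U)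
    (α : Fin 3) (a : Fin 2) :
    pd α (boost a φ) p = boost a (pd α φ) p +
      ((coordDir α).1 • pd a.succ φ p + (coordDir α).2 a • pd 0 φ p) := by
  have hd (β : Fin 3) : DifferentiableAt ℝ (pd β φ) p :=
    (h.pd (n := 1) hU β).differentiableAt_of_isOpen hU (n := 0) hp
  have h1 : DifferentiableAt ℝ (fun q : Spacetime => q.1) p := differentiableAt_fst
  have h2 : DifferentiableAt ℝ (fun q : Spacetime => q.2 a) p := by fun_prop
  have := pd_add (h1.smul (hd a.succ)) (h2.smul (hd 0)) α
  simp only [Pi.smul_apply', Pi.smul_def'] at this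
  change pd α (fun q => q.1 • pd a.succ φ q + q.2 a • pd 0 φ q) p = _
  rw [this, pd_smul h1 (hd _), pd_smul h2 (hd _), pd_fst, pd_coord]
  simp only [boost]
  rw [pd_comm hU h hp α a.succ, pd_comm hU h hp α 0]
  abel

theorem coordDir_zero : coordDir 0 = (1, 0) := rfl

theorem coordDir_succ (a : Fin 2) : coordDir a.succ = (0, EuclideanSpace.single a 1) := rfl

theorem abs_coordDir_fst_le (α : Fin 3) : |(coordDir α).1| ≤ 1 := by
  refine Fin.cases ?_ (fun b => ?_) α
  · simp [coordDir_zero]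
  · simp [coordDir_succ]

theorem abs_coordDir_snd_le (α : Fin 3) (a : Fin 2) : |(coordDir α).2 a| ≤ 1 := by
  refine Fin.cases ?_ (fun b => ?_) α
  · simp [coordDir_zero]
  · simp only [coordDir_succ]
    fin_cases a <;> fin_cases b <;> simp

/-- A boost corrected by a constant linear map. -/
def opBoost (T : Fin 2 → E →L[ℝ] E) (a : Fin 2) (φ : Spacetime → E) : Spacetime → E :=
  fun p => boost a φ p - T a (φ p)

/-- `∂^I` after a word of corrected boosts. -/
def opIter (T : Fin 2 → E →L[ℝ] E) (I : List (Fin 3)) (J : List (Fin 2))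
    (φ : Spacetime → E) : Spacetime → E :=
  pdIter I (J.foldr (opBoost T) φ)

variable {T : Fin 2 → E →L[ℝ] E}

theorem opIter_nil_nil : opIter T [] [] φ = φ := rfl

theorem opIter_cons (α : Fin 3) (I : List (Fin 3)) (J : List (Fin 2)) :
    opIter T (α :: I) J φ = pd α (opIter T I J φ) := rfl

theorem opIter_nil_cons (a : Fin 2) (J : List (Fin 2)) :
    opIter T [] (a :: J) φ = opBoost T a (opIter T [] J φ) := rfl

theorem ContDiffOn.opBoost {n : ℕ} (hU : IsOpen U)
    (h : ContDiffOn ℝ ((n + 1 : ℕ) : WithTop ℕ∞) φ U) (a : Fin 2) :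
    ContDiffOn ℝ (n : WithTop ℕ∞) (opBoost T a φ) U :=
  (h.boost hU a).sub ((T a).contDiff.comp_contDiffOn (h.of_le (by norm_cast; omega)))

theorem Set.EqOn.opBoost (hU : IsOpen U) (h : Set.EqOn φ φ' U) (a : Fin 2) :
    Set.EqOn (opBoost T a φ) (opBoost T a φ') U := by
  intro p hp
  simp only [_root_.opBoost, h.boost hU a hp, h hp]

theorem ContDiffOn.opIter {n : ℕ} (hU : IsOpen U) (I : List (Fin 3)) (J : List (Fin 2))
    (h : ContDiffOn ℝ ((n + (I.length + J.length) : ℕ) : WithTop ℕ∞) φ U) :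
    ContDiffOn ℝ (n : WithTop ℕ∞) (opIter T I J φ) U := by
  induction I generalizing n with
  | nil =>
    induction J generalizing n with
    | nil => simpa [opIter_nil_nil] using h
    | cons a J ih =>
      rw [opIter_nil_cons]
      refine ContDiffOn.opBoost hU (ih (h.of_le ?_)) a
      simp only [List.length_cons, List.length_nil]; norm_cast; omega
  | cons α I ih =>
    rw [opIter_cons]
    refine ContDiffOn.pd hU (ih (h.of_le ?_)) α
    simp only [List.length_cons]; norm_cast; omega

end Calculus
end

noncomputable section

/-! ### Combinations of normal-form derivatives, with explicit constants. -/

section Generated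

variable {E : Type*} [NormedAddCommGroup E] [NormedSpace ℝ E]
  {T : Fin 2 → E →L[ℝ] E} {U : Set Spacetime} {φ : Spacetime → E}

/-- `Gen T U φ k c f`: on `U` the function `f` is a combination of the derivatives
`opIter T I J φ` of order at most `k`, with constant operator coefficients whose norms sum to at
most `c`. -/
inductive Gen (T : Fin 2 → E →L[ℝ] E) (U : Set Spacetime) (φ : Spacetime → E) :
    ℕ → ℝ → (Spacetime → E) → Prop
  | base (I J k) : I.length + J.length ≤ k → Gen T U φ k 1 (opIter T I J φ)
  | add {k c d f g} : Gen T U φ k c f → Gen T U φ k d g → Gen T U φ k (c + d) (fun p => f p + g p)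
  | map {k c f} (A : E →L[ℝ] E) : Gen T U φ k c f → Gen T U φ k (‖A‖ * c) (fun p => A (f p))
  | congr {k c f g} : Gen T U φ k c f → Set.EqOn f g U → Gen T U φ k c g
  | mono {k l c d f} : Gen T U φ k c f → k ≤ l → c ≤ d → Gen T U φ l d f

namespace Gen

variable {k l n : ℕ} {c d : ℝ} {f g : Spacetime → E}

theorem nonneg (h : Gen T U φ k c f) : 0 ≤ c := by
  induction h with
  | base => exact zero_le_one
  | add _ _ h1 h2 => exact add_nonneg h1 h2
  | map A _ h => exact mul_nonneg (norm_nonneg A) h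
  | congr _ _ h => exact h
  | mono _ _ hc h => exact h.trans hc

theorem contDiffOn (hU : IsOpen U) (h : Gen T U φ k c f)
    (hφ : ContDiffOn ℝ ((n + k : ℕ) : WithTop ℕ∞) φ U) :
    ContDiffOn ℝ (n : WithTop ℕ∞) f U := by
  induction h with
  | base I J k hk => exact (hφ.of_le (by norm_cast; omega)).opIter hU I J
  | add _ _ h1 h2 => exact (h1 hφ).add (h2 hφ)
  | map A _ h => exact A.contDiff.comp_contDiffOn (h hφ)
  | congr _ he h => exact (h hφ).congr fun p hp => (he hp).symm
  | mono _ hk _ h => exact h (hφ.of_le (by norm_cast; omega))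

theorem smul (r : ℝ) (h : Gen T U φ k c f) : Gen T U φ k (|r| * c) (fun p => r • f p) := by
  have := h.map (r • ContinuousLinearMap.id ℝ E)
  refine Gen.mono this le_rfl ?_
  refine mul_le_mul_of_nonneg_right ?_ h.nonneg
  rw [norm_smul, Real.norm_eq_abs]
  exact mul_le_of_le_one_right (abs_nonneg r) ContinuousLinearMap.norm_id_le

theorem smul_le_one {r : ℝ} (hr : |r| ≤ 1) (h : Gen T U φ k c f) :
    Gen T U φ k c (fun p => r • f p) :=
  (h.smul r).mono le_rfl (mul_le_of_le_one_left h.nonneg hr)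

/-- Translations stand on the left in the normal form, so one more costs nothing; only boosts have
to be commuted into place and enlarge the constant. -/
theorem pd (hU : IsOpen U) (α : Fin 3) (h : Gen T U φ k c f)
    (hφ : ContDiffOn ℝ ((k + 1 : ℕ) : WithTop ℕ∞) φ U) : Gen T U φ (k + 1) c (pd α f) := by
  induction h with
  | base I J k hk =>
    rw [← opIter_cons]
    exact base _ _ _ (by simp only [List.length_cons]; omega)
  | @add k _ _ f g hf hg h1 h2 =>
    refine ((h1 hφ).add (h2 hφ)).congr fun p hp => ?_
    rw [add_comm] at hφ
    exact (pd_add ((hf.contDiffOn hU (n := 1) hφ).differentiableAt_of_isOpen hU (n := 0) hp)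
      ((hg.contDiffOn hU (n := 1) hφ).differentiableAt_of_isOpen hU (n := 0) hp) α).symm
  | @map k _ f A hf h =>
    refine ((h hφ).map A).congr fun p hp => ?_
    rw [add_comm] at hφ
    exact (pd_clm A
      ((hf.contDiffOn hU (n := 1) hφ).differentiableAt_of_isOpen hU (n := 0) hp) α).symm
  | congr _ he h => exact (h hφ).congr (he.pd hU α)
  | mono _ hk hc h => exact (h (hφ.of_le (by norm_cast; omega))).mono (by omega) hc

/-- The boost is moved to the right through `∂^I`. Each translation passed leaves a commutator of
two terms with coefficients at most 1, adding 2 to the constant. At the end `L_a` is the corrected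
boost plus `T a`, which accounts for the initial 2. -/
theorem boost_base (hU : IsOpen U) (hT : ∀ a, ‖T a‖ ≤ 1) (a : Fin 2) (I : List (Fin 3))
    (J : List (Fin 2))
    (hφ : ContDiffOn ℝ ((I.length + J.length + 1 : ℕ) : WithTop ℕ∞) φ U) :
    Gen T U φ (I.length + J.length + 1) (2 * (I.length + 1)) (boost a (opIter T I J φ)) := by
  induction I with
  | nil =>
    have h1 : Gen T U φ (J.length + 1) 1 (opIter T [] (a :: J) φ) := base _ _ _ (by simp)
    have h2 : Gen T U φ (J.length + 1) 1 (opIter T [] J φ) := base _ _ _ (by simp)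
    have h3 := (h1.add (h2.map (T a)))
    simp only [List.length_nil, zero_add, CharP.cast_eq_zero, mul_one]
    refine Gen.mono (h3.congr fun p _ => ?_) le_rfl (by linarith [hT a])
    simp [opIter_nil_cons, opBoost]
  | cons α I ih =>
    simp only [List.length_cons] at hφ ⊢
    have hφ' : ContDiffOn ℝ ((I.length + J.length + 1 : ℕ) : WithTop ℕ∞) φ U :=
      hφ.of_le (by norm_cast; omega)
    have hφ2 : ContDiffOn ℝ ((2 : ℕ) : WithTop ℕ∞) (opIter T I J φ) U :=
      ContDiffOn.opIter hU I J (hφ.of_le (by norm_cast; omega))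
    have h1 := (ih hφ').pd hU α (hφ.of_le (by norm_cast; omega))
    have hb (β : Fin 3) : Gen T U φ (I.length + J.length + 1) 1 (opIter T (β :: I) J φ) :=
      base _ _ _ (by simp only [List.length_cons]; omega)
    have h2 := (hb a.succ).smul_le_one (r := -(coordDir α).1)
      (by simpa using abs_coordDir_fst_le α)
    have h3 := (hb 0).smul_le_one (r := -(coordDir α).2 a)
      (by simpa using abs_coordDir_snd_le α a)
    have h4 := h1.add ((h2.add h3).mono (Nat.le_succ _) le_rfl)
    refine Gen.mono (h4.congr fun p hp => ?_) (by omega) (by push_cast; linarith)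
    simp only [opIter_cons, pd_boost hU hφ2 hp]
    simp only [neg_smul]
    abel

theorem boost (hU : IsOpen U) (hT : ∀ a, ‖T a‖ ≤ 1) (a : Fin 2) (h : Gen T U φ k c f)
    (hφ : ContDiffOn ℝ ((k + 1 : ℕ) : WithTop ℕ∞) φ U) :
    Gen T U φ (k + 1) (2 * (k + 1) * c) (boost a f) := by
  induction h with
  | base I J k hk =>
    refine (boost_base hU hT a I J (hφ.of_le (by norm_cast; omega))).mono (by omega) ?_
    have : (I.length : ℝ) ≤ k := by norm_cast; omega
    linarith
  | @add k _ _ f g hf hg h1 h2 =>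
    refine Gen.mono (((h1 hφ).add (h2 hφ)).congr fun p hp => ?_) le_rfl (by ring_nf; rfl)
    rw [add_comm] at hφ
    exact (boost_add ((hf.contDiffOn hU (n := 1) hφ).differentiableAt_of_isOpen hU (n := 0) hp)
      ((hg.contDiffOn hU (n := 1) hφ).differentiableAt_of_isOpen hU (n := 0) hp) a).symm
  | @map k _ f A hf h =>
    refine Gen.mono (((h hφ).map A).congr fun p hp => ?_) le_rfl (by ring_nf; rfl)
    rw [add_comm] at hφ
    exact (boost_clm A
      ((hf.contDiffOn hU (n := 1) hφ).differentiableAt_of_isOpen hU (n := 0) hp) a).symm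
  | congr _ he h => exact (h hφ).congr (he.boost hU a)
  | @mono k l c d f hg hk hc h =>
    refine (h (hφ.of_le (by norm_cast; omega))).mono (by omega) ?_
    have : (k : ℝ) ≤ l := by exact_mod_cast hk
    have := hg.nonneg
    gcongr

/-- With `T` the spinorial correction, this converts unmodified boosts into modified ones, so that
estimates need only be proved for `∂^I L̂^J ψ`. Each of the at most `m` boosts multiplies the
constant by at most `2(m + 1)`. -/
theorem pdIter_boostIter (hU : IsOpen U) (hT : ∀ a, ‖T a‖ ≤ 1) (I : List (Fin 3))
    (J : List (Fin 2)) {m : ℕ} (hm : I.length + J.length ≤ m)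
    (hφ : ContDiffOn ℝ (m : WithTop ℕ∞) φ U) :
    Gen T U φ (I.length + J.length) ((2 * (m + 1)) ^ m) (pdIter I (boostIter J φ)) := by
  have key : Gen T U φ (I.length + J.length) ((2 * (m + 1)) ^ J.length)
      (pdIter I (boostIter J φ)) := by
    induction I with
    | nil =>
      induction J with
      | nil => simpa [pdIter, boostIter, opIter_nil_nil] using base (T := T) (U := U) (φ := φ) [] [] 0 (by simp)
      | cons a J ih =>
        simp only [List.length_cons, List.length_nil, zero_add] at hm ih ⊢
        refine Gen.mono ((ih (by omega)).boost hU hT a (hφ.of_le (by norm_cast))) le_rfl ?_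
        rw [pow_succ']
        have : (J.length : ℝ) ≤ m := by norm_cast; omega
        gcongr
    | cons α I ih =>
      simp only [List.length_cons] at hm ⊢
      exact Gen.mono ((ih (by omega)).pd hU α (hφ.of_le (by norm_cast; omega))) (by omega) le_rfl
  refine key.mono le_rfl (pow_le_pow_right₀ ?_ (by omega))
  have : (0 : ℝ) ≤ m := by positivity
  linarith

end Gen

/-- Sums of products of derivatives of `v` and of `φ`, of total order at most `k`. -/
inductive PGen (S : Fin 2 → ℝ →L[ℝ] ℝ) (T : Fin 2 → E →L[ℝ] E) (U : Set Spacetime)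
    (v : Spacetime → ℝ) (φ : Spacetime → E) : ℕ → ℝ → (Spacetime → E) → Prop
  | base {k l m c d f g} : Gen S U v k c f → Gen T U φ l d g → k + l ≤ m →
      PGen S T U v φ m (c * d) (fun p => f p • g p)
  | add {k c d f g} : PGen S T U v φ k c f → PGen S T U v φ k d g →
      PGen S T U v φ k (c + d) (fun p => f p + g p)
  | congr {k c f g} : PGen S T U v φ k c f → Set.EqOn f g U → PGen S T U v φ k c g
  | mono {k l c d f} : PGen S T U v φ k c f → k ≤ l → c ≤ d → PGen S T U v φ l d f

namespace PGen

variable {S : Fin 2 → ℝ →L[ℝ] ℝ} {v : Spacetime → ℝ} {k l n : ℕ} {c d : ℝ} {f g : Spacetime → E}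

theorem nonneg (h : PGen S T U v φ k c f) : 0 ≤ c := by
  induction h with
  | base h1 h2 => exact mul_nonneg h1.nonneg h2.nonneg
  | add _ _ h1 h2 => exact add_nonneg h1 h2
  | congr _ _ h => exact h
  | mono _ _ hc h => exact h.trans hc

theorem contDiffOn (hU : IsOpen U) (h : PGen S T U v φ k c f)
    (hv : ContDiffOn ℝ ((n + k : ℕ) : WithTop ℕ∞) v U)
    (hφ : ContDiffOn ℝ ((n + k : ℕ) : WithTop ℕ∞) φ U) :
    ContDiffOn ℝ (n : WithTop ℕ∞) f U := by
  induction h with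
  | base h1 h2 hk =>
    exact (h1.contDiffOn hU (hv.of_le (by norm_cast; omega))).smul
      (h2.contDiffOn hU (hφ.of_le (by norm_cast; omega)))
  | add _ _ h1 h2 => exact (h1 hv hφ).add (h2 hv hφ)
  | congr _ he h => exact (h hv hφ).congr fun p hp => (he hp).symm
  | mono _ hk _ h => exact h (hv.of_le (by norm_cast; omega)) (hφ.of_le (by norm_cast; omega))

theorem map (A : E →L[ℝ] E) (hA : ‖A‖ ≤ 1) (h : PGen S T U v φ k c f) :
    PGen S T U v φ k c (fun p => A (f p)) := by
  induction h with
  | base h1 h2 hk =>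
    refine PGen.mono ((base h1 (h2.map A) hk).congr fun p _ => ?_) le_rfl ?_
    · simp
    · exact mul_le_mul_of_nonneg_left (mul_le_of_le_one_left h2.nonneg hA) h1.nonneg
  | add _ _ h1 h2 => exact (h1.add h2).congr fun p _ => (map_add A _ _).symm
  | congr _ he h => exact h.congr fun p hp => congrArg A (he hp)
  | mono _ hk hc h => exact h.mono hk hc

theorem pd (hU : IsOpen U) (α : Fin 3) (h : PGen S T U v φ k c f)
    (hv : ContDiffOn ℝ ((k + 1 : ℕ) : WithTop ℕ∞) v U)
    (hφ : ContDiffOn ℝ ((k + 1 : ℕ) : WithTop ℕ∞) φ U) :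
    PGen S T U v φ (k + 1) (2 * c) (pd α f) := by
  induction h with
  | @base k l m c d f g h1 h2 hk =>
    have h1' := h1.pd hU α (hv.of_le (by norm_cast; omega))
    have h2' := h2.pd hU α (hφ.of_le (by norm_cast; omega))
    refine PGen.mono (((base h1' h2 (m := m + 1) (by omega)).add
      (base h1 h2' (by omega))).congr fun p hp => ?_) le_rfl (by linarith)
    exact (pd_smul ((h1.contDiffOn hU (n := 1) (hv.of_le (by norm_cast; omega))
        ).differentiableAt_of_isOpen hU (n := 0) hp)
      ((h2.contDiffOn hU (n := 1) (hφ.of_le (by norm_cast; omega))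
        ).differentiableAt_of_isOpen hU (n := 0) hp) α).symm
  | @add k _ _ f g hf hg h1 h2 =>
    refine PGen.mono (((h1 hv hφ).add (h2 hv hφ)).congr fun p hp => ?_) le_rfl (by linarith)
    rw [add_comm] at hφ hv
    exact (pd_add ((hf.contDiffOn hU (n := 1) hv hφ).differentiableAt_of_isOpen hU (n := 0) hp)
      ((hg.contDiffOn hU (n := 1) hv hφ).differentiableAt_of_isOpen hU (n := 0) hp) α).symm
  | congr _ he h => exact (h hv hφ).congr (he.pd hU α)
  | mono _ hk hc h =>
    exact (h (hv.of_le (by norm_cast; omega)) (hφ.of_le (by norm_cast; omega))).mono (by omega)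
      (by linarith)

theorem boost (hU : IsOpen U) (hS : ∀ a, ‖S a‖ ≤ 1) (hT : ∀ a, ‖T a‖ ≤ 1) (a : Fin 2)
    (h : PGen S T U v φ k c f)
    (hv : ContDiffOn ℝ ((k + 1 : ℕ) : WithTop ℕ∞) v U)
    (hφ : ContDiffOn ℝ ((k + 1 : ℕ) : WithTop ℕ∞) φ U) :
    PGen S T U v φ (k + 1) (4 * (k + 1) * c) (boost a f) := by
  induction h with
  | @base k l m c d f g h1 h2 hk =>
    have h1' := h1.boost hU hS a (hv.of_le (by norm_cast; omega))
    have h2' := h2.boost hU hT a (hφ.of_le (by norm_cast; omega))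
    refine PGen.mono (((base h1' h2 (m := m + 1) (by omega)).add
      (base h1 h2' (by omega))).congr fun p hp => ?_) le_rfl ?_
    · exact (boost_smul ((h1.contDiffOn hU (n := 1) (hv.of_le (by norm_cast; omega))
          ).differentiableAt_of_isOpen hU (n := 0) hp)
        ((h2.contDiffOn hU (n := 1) (hφ.of_le (by norm_cast; omega))
          ).differentiableAt_of_isOpen hU (n := 0) hp) a).symm
    · have h3 : (k : ℝ) + l ≤ m := by exact_mod_cast hk
      have h4 := mul_nonneg h1.nonneg h2.nonneg
      have h5 : (0 : ℝ) ≤ m := by positivity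
      nlinarith [mul_le_mul_of_nonneg_right h3 h4]
  | @add k _ _ f g hf hg h1 h2 =>
    refine PGen.mono (((h1 hv hφ).add (h2 hv hφ)).congr fun p hp => ?_) le_rfl
      (by ring_nf; rfl)
    rw [add_comm] at hφ hv
    exact (boost_add ((hf.contDiffOn hU (n := 1) hv hφ).differentiableAt_of_isOpen hU (n := 0) hp)
      ((hg.contDiffOn hU (n := 1) hv hφ).differentiableAt_of_isOpen hU (n := 0) hp) a).symm
  | congr _ he h => exact (h hv hφ).congr (he.boost hU a)
  | @mono k l c d f hg hk hc h =>
    refine (h (hv.of_le (by norm_cast; omega)) (hφ.of_le (by norm_cast; omega))).mono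
      (by omega) ?_
    have : (k : ℝ) ≤ l := by exact_mod_cast hk
    have := hg.nonneg
    gcongr

theorem opBoost (hU : IsOpen U) (hS : ∀ a, ‖S a‖ ≤ 1) (hT : ∀ a, ‖T a‖ ≤ 1) (a : Fin 2)
    (h : PGen S T U v φ k c f)
    (hv : ContDiffOn ℝ ((k + 1 : ℕ) : WithTop ℕ∞) v U)
    (hφ : ContDiffOn ℝ ((k + 1 : ℕ) : WithTop ℕ∞) φ U) :
    PGen S T U v φ (k + 1) ((4 * (k + 1) + 1) * c) (opBoost T a f) := by
  have h1 := h.map (-(T a)) (by simpa using hT a)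
  refine PGen.mono (((h.boost hU hS hT a hv hφ).add (h1.mono (Nat.le_succ k) le_rfl)).congr
    fun p _ => ?_) le_rfl (by linarith)
  simp [_root_.opBoost, sub_eq_add_neg]

/-- Leibniz rule in normal form. A corrected boost yields two terms, each costing at most `2(m +
1)`, plus the zeroth-order correction of norm at most 1: hence the factor `4(m + 1) + 1`. A
translation costs only 2. -/
theorem opIter (hU : IsOpen U) (hS : ∀ a, ‖S a‖ ≤ 1) (hT : ∀ a, ‖T a‖ ≤ 1) (I : List (Fin 3))
    (J : List (Fin 2)) {m : ℕ} (hm : I.length + J.length ≤ m)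
    (hv : ContDiffOn ℝ (m : WithTop ℕ∞) v U) (hφ : ContDiffOn ℝ (m : WithTop ℕ∞) φ U) :
    PGen S T U v φ (I.length + J.length) ((4 * (m + 1) + 1) ^ m)
      (opIter T I J (fun p => v p • φ p)) := by
  have key : PGen S T U v φ (I.length + J.length) ((4 * (m + 1) + 1) ^ (I.length + J.length))
      (_root_.opIter T I J (fun p => v p • φ p)) := by
    induction I with
    | nil =>
      induction J with
      | nil =>
        have h1 : Gen S U v 0 1 v := Gen.base [] [] 0 (by simp)
        have h2 : Gen T U φ 0 1 φ := Gen.base [] [] 0 (by simp)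
        simpa [opIter_nil_nil] using base h1 h2 (le_refl 0)
      | cons a J ih =>
        simp only [List.length_cons, List.length_nil, zero_add] at hm ih ⊢
        refine PGen.mono ((ih (by omega)).opBoost hU hS hT a (hv.of_le (by norm_cast))
          (hφ.of_le (by norm_cast))) le_rfl ?_
        rw [pow_succ']
        have : (J.length : ℝ) ≤ m := by norm_cast; omega
        gcongr
    | cons α I ih =>
      simp only [List.length_cons] at hm ⊢
      refine PGen.mono ((ih (by omega)).pd hU α (hv.of_le (by norm_cast; omega))
        (hφ.of_le (by norm_cast; omega))) (by omega) ?_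
      rw [show I.length + 1 + J.length = (I.length + J.length) + 1 by omega, pow_succ']
      have : (0 : ℝ) ≤ m := by positivity
      gcongr
      linarith
  refine key.mono le_rfl (pow_le_pow_right₀ ?_ (by omega))
  have : (0 : ℝ) ≤ m := by positivity
  linarith

end PGen

end Generated
end

noncomputable section

/-! ### Topology of the hyperboloidal region and of the cone. -/

section Region

variable {s₁ : EReal}

theorem hypPt_fst_sq (s : ℝ) (x : Space2) : (hypPt s x).1 ^ 2 = s ^ 2 + ‖x‖ ^ 2 :=
  Real.sq_sqrt (by positivity)

theorem norm_lt_hypPt_fst {s : ℝ} (hs : 0 < s) (x : Space2) : ‖x‖ < (hypPt s x).1 :=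
  Real.lt_sqrt_of_sq_lt (by nlinarith)

theorem hypPt_fst_pos {s : ℝ} (hs : 0 < s) (x : Space2) : 0 < (hypPt s x).1 :=
  (norm_nonneg x).trans_lt (norm_lt_hypPt_fst hs x)

theorem hypPt_mem_hypRegion {s : ℝ} (hs : 2 ≤ s) (hs₁ : (s : EReal) < s₁) (x : Space2) :
    hypPt s x ∈ hypRegion s₁ := ⟨s, x, hs, hs₁, rfl⟩

theorem contDiff_hypPt {s : ℝ} (hs : 0 < s) {n : WithTop ℕ∞} : ContDiff ℝ n (hypPt s) := by
  refine ContDiff.prodMk (ContDiff.sqrt ?_ fun x => ?_) contDiff_id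
  · exact contDiff_const.add (contDiff_id.norm_sq ℝ)
  · positivity

/-- The part of the region strictly above the initial hyperboloid. -/
def openRegion (s₁ : EReal) : Set Spacetime :=
  {p | ‖p.2‖ < p.1 ∧ 2 < Real.sqrt (p.1 ^ 2 - ‖p.2‖ ^ 2) ∧
    (Real.sqrt (p.1 ^ 2 - ‖p.2‖ ^ 2) : EReal) < s₁}

theorem isOpen_openRegion (s₁ : EReal) : IsOpen (openRegion s₁) := by
  have h : Continuous fun p : Spacetime => Real.sqrt (p.1 ^ 2 - ‖p.2‖ ^ 2) := by fun_prop
  exact (isOpen_lt (continuous_norm.comp continuous_snd) continuous_fst).inter ((isOpen_lt continuous_const h).inter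
    (isOpen_lt (continuous_coe_real_ereal.comp h) continuous_const))

theorem openRegion_subset (s₁ : EReal) : openRegion s₁ ⊆ hypRegion s₁ := by
  rintro ⟨t, x⟩ ⟨h1, h2, h3⟩
  refine ⟨_, x, h2.le, h3, ?_⟩
  simp only at h1 h2
  have hx := norm_nonneg x
  refine Prod.ext ?_ rfl
  simp only [hypPt]
  rw [Real.sq_sqrt (by nlinarith), sub_add_cancel, Real.sqrt_sq (by linarith)]

/-- The region contains its lower boundary `H_2`. A point of `H_s` is the limit, as `r ↓ s`, of the
points of `H_r` above the same `x`, which lie in the open part. -/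
theorem hypRegion_subset_closure_openRegion (s₁ : EReal) :
    hypRegion s₁ ⊆ closure (openRegion s₁) := by
  rintro _ ⟨s, x, hs, hs₁, rfl⟩
  -- A finite `b` is interposed because `s₁` may be infinite.
  obtain ⟨b, hsb, hb⟩ := EReal.lt_iff_exists_real_btwn.1 hs₁
  have hsb : s < b := by exact_mod_cast hsb
  have hc : Continuous fun r : ℝ => hypPt r x := by
    unfold hypPt
    fun_prop
  have hcl : s ∈ closure (Set.Ioo s b) := by
    rw [closure_Ioo hsb.ne]
    exact ⟨le_rfl, hsb.le⟩
  refine closure_mono ?_ (image_closure_subset_closure_image hc ⟨s, hcl, rfl⟩)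
  rintro _ ⟨r, ⟨hr1, hr2⟩, rfl⟩
  have hr : 2 < r := by linarith
  have hsq : Real.sqrt ((hypPt r x).1 ^ 2 - ‖(hypPt r x).2‖ ^ 2) = r := by
    rw [hypPt_fst_sq]
    simp only [hypPt, add_sub_cancel_right]
    exact Real.sqrt_sq (by linarith)
  refine ⟨norm_lt_hypPt_fst (by linarith) x, ?_, ?_⟩ <;> simp only [hsq]
  · exact hr
  · exact lt_trans (by exact_mod_cast hr2) hb

theorem isClosed_coneK : IsClosed coneK :=
  (isClosed_le continuous_const continuous_fst).inter
    (isClosed_le (by fun_prop) continuous_fst)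

/-- This property allows equations known only on the region to be differentiated up to `H_2`. -/
theorem hypRegion_subset_closure_interior (s₁ : EReal) :
    hypRegion s₁ ⊆ closure (interior (hypRegion s₁)) :=
  (hypRegion_subset_closure_openRegion s₁).trans
    (closure_mono (interior_maximal (openRegion_subset s₁) (isOpen_openRegion s₁)))

theorem hypRegion_diff_coneK_subset (s₁ : EReal) :
    hypRegion s₁ \ coneK ⊆ closure (interior (hypRegion s₁ \ coneK)) := by
  have ho : IsOpen (coneKᶜ) := isClosed_coneK.isOpen_compl
  have hi : coneKᶜ ∩ interior (hypRegion s₁) ⊆ interior (hypRegion s₁ \ coneK) :=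
    interior_maximal (fun p hp => ⟨interior_subset hp.2, hp.1⟩) (ho.inter isOpen_interior)
  intro p hp
  exact closure_mono hi (ho.inter_closure ⟨hp.2, hypRegion_subset_closure_interior s₁ hp.1⟩)

/-- Points of `H_s` in the cone lie over a bounded set. -/
theorem hypPt_notMem_coneK {s : ℝ} {x : Space2} (hx : s ^ 2 < ‖x‖) :
    hypPt s x ∉ coneK := by
  rintro ⟨-, h⟩
  have h1 := hypPt_fst_sq s x
  have h2 : ‖x‖ + 1 ≤ (hypPt s x).1 := h
  -- From `t ≥ r + 1` and `t² = s² + r²` one gets `2r + 1 ≤ s²`, incompatible with `s² < r`.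
  nlinarith [norm_nonneg x]

end Region

/-! ### Differentiating identities that hold on a non-open set. -/

section Propagation

variable {E : Type*} [NormedAddCommGroup E] [NormedSpace ℝ E]
  {T : Fin 2 → E →L[ℝ] E} {U S : Set Spacetime} {f g : Spacetime → E}

/-- On the interior the derivatives agree trivially; continuity of both derivatives carries this to
the rest of `S`, which lies in the closure of its interior. -/
theorem eqOn_fderiv_of_subset_closure_interior (hU : IsOpen U) (hSU : S ⊆ U)
    (hS : S ⊆ closure (interior S)) (hf : ContDiffOn ℝ ((1 : ℕ) : WithTop ℕ∞) f U)
    (hg : ContDiffOn ℝ ((1 : ℕ) : WithTop ℕ∞) g U) (h : Set.EqOn f g S) :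
    Set.EqOn (fderiv ℝ f) (fderiv ℝ g) S := by
  have h0 : Set.EqOn (fderiv ℝ f) (fderiv ℝ g) (interior S) := fun p hp =>
    (Filter.eventuallyEq_of_mem (isOpen_interior.mem_nhds hp)
      (h.mono interior_subset)).fderiv_eq
  exact h0.of_subset_closure
    ((hf.continuousOn_fderiv_of_isOpen hU (by norm_cast)).mono hSU)
    ((hg.continuousOn_fderiv_of_isOpen hU (by norm_cast)).mono hSU) interior_subset hS

theorem eqOn_opIter (hU : IsOpen U) (hSU : S ⊆ U) (hS : S ⊆ closure (interior S))
    (I : List (Fin 3)) (J : List (Fin 2))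
    (hf : ContDiffOn ℝ ((I.length + J.length : ℕ) : WithTop ℕ∞) f U)
    (hg : ContDiffOn ℝ ((I.length + J.length : ℕ) : WithTop ℕ∞) g U) (h : Set.EqOn f g S) :
    Set.EqOn (opIter T I J f) (opIter T I J g) S := by
  induction I with
  | nil =>
    induction J with
    | nil => simpa [opIter_nil_nil] using h
    | cons a J ih =>
      simp only [List.length_cons, List.length_nil, zero_add] at hf hg ih
      have h1 := ih (hf.of_le (by norm_cast; omega)) (hg.of_le (by norm_cast; omega))
      have h2 := eqOn_fderiv_of_subset_closure_interior hU hSU hS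
        (ContDiffOn.opIter (T := T) (n := 1) hU [] J (hf.of_le (by simp; norm_cast; omega)))
        (ContDiffOn.opIter (T := T) (n := 1) hU [] J (hg.of_le (by simp; norm_cast; omega))) h1
      intro p hp
      simp only [opIter_nil_cons, opBoost, boost, pd, h2 hp, h1 hp]
  | cons α I ih =>
    simp only [List.length_cons] at hf hg ih
    have h1 := ih (hf.of_le (by norm_cast; omega)) (hg.of_le (by norm_cast; omega))
    have h2 := eqOn_fderiv_of_subset_closure_interior hU hSU hS
      (ContDiffOn.opIter (T := T) (n := 1) hU I J (hf.of_le (by norm_cast; omega)))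
      (ContDiffOn.opIter (T := T) (n := 1) hU I J (hg.of_le (by norm_cast; omega))) h1
    intro p hp
    simp only [opIter_cons, pd, h2 hp]

theorem opIter_zero_fun (I : List (Fin 3)) (J : List (Fin 2)) :
    opIter T I J (fun _ => (0 : E)) = fun _ => 0 := by
  induction I with
  | nil =>
    induction J with
    | nil => rfl
    | cons a J ih => funext p; simp [opIter_nil_cons, ih, opBoost, boost, pd]
  | cons α I ih => funext p; simp [opIter_cons, ih, pd]

theorem Gen.eqOn_zero {k : ℕ} {c : ℝ} {φ : Spacetime → E} (hU : IsOpen U) (hSU : S ⊆ U)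
    (hS : S ⊆ closure (interior S)) (h : Gen T U φ k c f)
    (hφ : ContDiffOn ℝ (k : WithTop ℕ∞) φ U) (h0 : ∀ p ∈ S, φ p = 0) : ∀ p ∈ S, f p = 0 := by
  induction h with
  | base I J k hk =>
    intro p hp
    have := eqOn_opIter (T := T) hU hSU hS I J (hφ.of_le (by norm_cast)) contDiffOn_const
      (g := fun _ => 0) h0 hp
    rw [this, opIter_zero_fun]
  | add _ _ h1 h2 => intro p hp; simp [h1 hφ p hp, h2 hφ p hp]
  | map A _ h => intro p hp; simp [h hφ p hp]
  | congr _ he h => intro p hp; rw [← he (hSU hp)]; exact h hφ p hp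
  | mono _ hk _ h => exact h (hφ.of_le (by norm_cast))

end Propagation
end

noncomputable section

/-! ### The embedding of `W^{2,1}` into `L^∞` in the plane. -/

section PlaneSobolev

/-- A function on the line with compact support is bounded by the integral of its derivative. -/
theorem abs_le_integral_abs_deriv {g g' : ℝ → ℝ} (hg : ∀ x, HasDerivAt g (g' x) x)
    (hc : Continuous g') (hs : HasCompactSupport g) (x : ℝ) : |g x| ≤ ∫ y, |g' y| := by
  have hd : deriv g = g' := funext fun x => (hg x).deriv
  have hs' : HasCompactSupport g' := hd ▸ hs.deriv
  have hi : Integrable g' := hc.integrable_of_hasCompactSupport hs'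
  have h1 : ∫ y in Set.Iic x, g' y = g x - 0 :=
    integral_Iic_of_hasDerivAt_of_tendsto' (fun y _ => hg y) hi.integrableOn
      (hs.is_zero_at_infty.mono_left atBot_le_cocompact)
  rw [sub_zero] at h1
  rw [← h1]
  calc |∫ y in Set.Iic x, g' y| ≤ ∫ y in Set.Iic x, |g' y| := abs_integral_le_integral_abs
    _ ≤ ∫ y, |g' y| := setIntegral_le_integral hi.abs (Filter.Eventually.of_forall fun y =>
        abs_nonneg _)

/-- `∂_a h` on the plane. -/
def dirDeriv {E : Type*} [NormedAddCommGroup E] [NormedSpace ℝ E] (a : Fin 2) (h : Space2 → E) :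
    Space2 → E :=
  fun x => fderiv ℝ h x (EuclideanSpace.single a 1)

def planePt (q : ℝ × ℝ) : Space2 := !₂[q.1, q.2]

theorem measurePreserving_planePt :
    MeasurePreserving planePt (volume : Measure (ℝ × ℝ)) (volume : Measure Space2) := by
  have h1 := (volume_preserving_finTwoArrow ℝ).symm
  have h2 := (EuclideanSpace.volume_preserving_symm_measurableEquiv_toLp (Fin 2)).symm
  exact h2.comp h1

theorem hasDerivAt_planePt_fst {h : Space2 → ℝ} {a b : ℝ}
    (hh : DifferentiableAt ℝ h (planePt (a, b))) :
    HasDerivAt (fun y => h (planePt (y, b))) (dirDeriv 0 h (planePt (a, b))) a := by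
  have h1 : HasDerivAt (fun y => planePt (y, b)) (EuclideanSpace.single 0 1) a := by
    have h2 : (fun y => planePt (y, b)) =
        fun y => planePt (0, b) + y • (EuclideanSpace.single 0 1 : Space2) := by
      funext y
      ext i
      fin_cases i <;> simp [planePt]
    rw [h2]
    simpa using ((hasDerivAt_id a).smul_const (EuclideanSpace.single 0 1 : Space2)).const_add
      (planePt (0, b))
  exact hh.hasFDerivAt.comp_hasDerivAt a h1

theorem hasDerivAt_planePt_snd {h : Space2 → ℝ} {a b : ℝ}
    (hh : DifferentiableAt ℝ h (planePt (a, b))) :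
    HasDerivAt (fun y => h (planePt (a, y))) (dirDeriv 1 h (planePt (a, b))) b := by
  have h1 : HasDerivAt (fun y => planePt (a, y)) (EuclideanSpace.single 1 1) b := by
    have h2 : (fun y => planePt (a, y)) =
        fun y => planePt (a, 0) + y • (EuclideanSpace.single 1 1 : Space2) := by
      funext y
      ext i
      fin_cases i <;> simp [planePt]
    rw [h2]
    simpa using ((hasDerivAt_id b).smul_const (EuclideanSpace.single 1 1 : Space2)).const_add
      (planePt (a, 0))
  exact hh.hasFDerivAt.comp_hasDerivAt b h1

/-- The fundamental theorem of calculus is applied once in each variable: `|h|` is at most the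
integral of `|∂₁h|` along a line, and `|∂₁h|` at most the integral of `|∂₀∂₁h|` along a transversal
line. -/
theorem abs_le_integral_dirDeriv_dirDeriv {h : Space2 → ℝ} (hh : ContDiff ℝ 2 h)
    (hs : HasCompactSupport h) (x : Space2) :
    |h x| ≤ ∫ y, |dirDeriv 0 (dirDeriv 1 h) y| := by
  have hd1 : ContDiff ℝ 1 (dirDeriv 1 h) :=
    (hh.fderiv_right (m := 1) (by norm_num)).clm_apply contDiff_const
  have hd01 : ContDiff ℝ 0 (dirDeriv 0 (dirDeriv 1 h)) :=
    (hd1.fderiv_right (m := 0) (by norm_num)).clm_apply contDiff_const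
  have hs1 : HasCompactSupport (dirDeriv 1 h) := hs.fderiv_apply ℝ _
  have hs01 : HasCompactSupport (dirDeriv 0 (dirDeriv 1 h)) := hs1.fderiv_apply ℝ _
  set G : ℝ × ℝ → ℝ := fun q => |dirDeriv 0 (dirDeriv 1 h) (planePt q)| with hG
  have hpc : Continuous planePt := by
    unfold planePt
    fun_prop
  have hint : Integrable (fun y => |dirDeriv 0 (dirDeriv 1 h) y|) :=
    (hd01.continuous.integrable_of_hasCompactSupport hs01).abs
  have hGi : Integrable G := measurePreserving_planePt.integrable_comp_of_integrable hint
  have hnorm1 (a b : ℝ) : |a| ≤ ‖planePt (a, b)‖ := by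
    simpa [planePt] using PiLp.norm_apply_le (planePt (a, b)) 0
  have hnorm2 (a b : ℝ) : |b| ≤ ‖planePt (a, b)‖ := by
    simpa [planePt] using PiLp.norm_apply_le (planePt (a, b)) 1
  -- Restrictions to coordinate lines keep compact support, since `|y|` is at most the norm of the
  -- point with parameter `y`.
  have hcs {g : Space2 → ℝ} (hg : HasCompactSupport g) {e : ℝ → Space2}
      (he : ∀ y, |y| ≤ ‖e y‖) : HasCompactSupport fun y => g (e y) := by
    obtain ⟨R, hR⟩ := hg.isCompact.isBounded.subset_closedBall 0
    refine HasCompactSupport.intro (isCompact_closedBall (0 : ℝ) R) fun y hy => ?_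
    by_contra hne
    have := hR (subset_tsupport g hne)
    rw [mem_closedBall_zero_iff] at this hy
    exact hy ((he y).trans this)
  have step1 (a b : ℝ) : |dirDeriv 1 h (planePt (a, b))| ≤ ∫ y, G (y, b) :=
    abs_le_integral_abs_deriv
      (fun y => hasDerivAt_planePt_fst (hd1.differentiable (by simp) _))
      (hd01.continuous.comp (hpc.comp (by fun_prop)))
      (hcs hs1 fun y => hnorm1 y b) a
  have step2 (a b : ℝ) : |h (planePt (a, b))| ≤ ∫ y, |dirDeriv 1 h (planePt (a, y))| :=
    abs_le_integral_abs_deriv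
      (fun y => hasDerivAt_planePt_snd (hh.differentiable (by simp) _))
      (hd1.continuous.comp (hpc.comp (by fun_prop)))
      (hcs hs fun y => hnorm2 a y) b
  have hx : x = planePt (x 0, x 1) := by
    ext i
    fin_cases i <;> simp [planePt]
  rw [hx]
  refine (step2 _ _).trans ?_
  calc ∫ y, |dirDeriv 1 h (planePt (x 0, y))| ≤ ∫ b, ∫ a, G (a, b) := by
        refine integral_mono_of_nonneg (Filter.Eventually.of_forall fun y => abs_nonneg _)
          hGi.integral_prod_right (Filter.Eventually.of_forall fun y => step1 _ _)
    _ = ∫ q, G q := (integral_prod_symm G hGi).symm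
    _ = ∫ y, |dirDeriv 0 (dirDeriv 1 h) y| := by
        rw [← measurePreserving_planePt.map_eq, integral_map
          measurePreserving_planePt.aemeasurable]
        rw [measurePreserving_planePt.map_eq]
        exact hint.aestronglyMeasurable

end PlaneSobolev

/-! ### Derivatives along hyperboloids and the Sobolev inequality in integral form. -/

section HyperboloidSobolev

variable {E : Type*} [NormedAddCommGroup E] [NormedSpace ℝ E] {U : Set Spacetime}

/-- The derivatives along the hyperboloid are the normalized boosts. -/
theorem dirDeriv_comp_hypPt {s : ℝ} (hs : 0 < s) {f : Spacetime → E} {x : Space2}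
    (hf : DifferentiableAt ℝ f (hypPt s x)) (a : Fin 2) :
    dirDeriv a (fun y => f (hypPt s y)) x = (hypPt s x).1⁻¹ • boost a f (hypPt s x) := by
  have ht := hypPt_fst_pos hs x
  -- On `H_s` the gradient of `t = √(s² + |x|²)` is `x/t`, so the tangential derivative is `∂_a +
  -- (x_a/t)∂_t = t⁻¹L_a`.
  have h1 : HasFDerivAt (fun y : Space2 => (hypPt s y).1)
      ((hypPt s x).1⁻¹ • innerSL ℝ x) x := by
    have h2 : HasFDerivAt (fun y : Space2 => s ^ 2 + ‖y‖ ^ 2) (2 • innerSL ℝ x) x :=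
      (hasStrictFDerivAt_norm_sq x).hasFDerivAt.const_add _
    have h3 := h2.sqrt (by positivity)
    refine HasFDerivAt.congr_fderiv h3 ?_
    ext y
    simp [hypPt]
    ring
  have h4 : HasFDerivAt (hypPt s)
      (((hypPt s x).1⁻¹ • innerSL ℝ x).prod (ContinuousLinearMap.id ℝ Space2)) x :=
    h1.prodMk (hasFDerivAt_id x)
  have h5 := hf.hasFDerivAt.comp x h4
  have h6 : fderiv ℝ (fun y => f (hypPt s y)) x = _ := h5.fderiv
  simp only [dirDeriv, h6, boost, pd]
  rw [smul_add, smul_smul, smul_smul, inv_mul_cancel₀ ht.ne', one_smul]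
  simp only [ContinuousLinearMap.comp_apply, ContinuousLinearMap.prod_apply]
  rw [coordDir_succ, coordDir_zero, 
    ← map_smul (fderiv ℝ f (hypPt s x)), ← map_add]
  congr 1
  refine Prod.ext ?_ ?_
  · simp [hypPt, EuclideanSpace.inner_single_right]
  · simp [hypPt]

theorem boost_norm_sq {E : Type*} [NormedAddCommGroup E] [InnerProductSpace ℝ E]
    {f g : Spacetime → E} {p : Spacetime}
    (hf : DifferentiableAt ℝ f p) (hg : DifferentiableAt ℝ g p) (a : Fin 2) :
    boost a (fun q => inner ℝ (f q) (g q)) p =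
      inner ℝ (boost a f p) (g p) + inner ℝ (f p) (boost a g p) := by
  simp only [boost, pd, fderiv_inner_apply ℝ hf hg, inner_add_left, inner_add_right,
    inner_smul_left, inner_smul_right, smul_eq_mul]
  simp
  ring

theorem boost_inv_fst {p : Spacetime} (hp : p.1 ≠ 0) (a : Fin 2) :
    boost a (fun q : Spacetime => q.1⁻¹) p = - (p.2 a * (p.1 ^ 2)⁻¹) := by
  have h : HasFDerivAt (fun q : Spacetime => q.1⁻¹)
      (-(p.1 ^ 2)⁻¹ • ContinuousLinearMap.fst ℝ ℝ Space2) p :=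
    (hasDerivAt_inv hp).comp_hasFDerivAt p (ContinuousLinearMap.fst ℝ ℝ Space2).hasFDerivAt
  simp [boost, pd, h.fderiv, coordDir_succ, coordDir_zero]

/-- The second derivative along the hyperboloid in terms of boosts. -/
theorem dirDeriv_dirDeriv_comp_hypPt {s : ℝ} (hs : 0 < s) (hU : IsOpen U)
    (hsU : ∀ x, hypPt s x ∈ U) {f : Spacetime → E}
    (hf : ContDiffOn ℝ ((2 : ℕ) : WithTop ℕ∞) f U) (x : Space2) (a b : Fin 2) :
    dirDeriv a (dirDeriv b (fun y => f (hypPt s y))) x =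
      ((hypPt s x).1⁻¹) ^ 2 • (boost a (boost b f) (hypPt s x)
        - (x a / (hypPt s x).1) • boost b f (hypPt s x)) := by
  have ht := hypPt_fst_pos hs x
  have h1 : dirDeriv b (fun y => f (hypPt s y)) =
      fun y => (fun p : Spacetime => p.1⁻¹ • boost b f p) (hypPt s y) :=
    funext fun y => dirDeriv_comp_hypPt hs
      (hf.differentiableAt_of_isOpen hU (n := 1) (hsU y)) b
  have hb : DifferentiableAt ℝ (boost b f) (hypPt s x) :=
    (hf.boost hU (n := 1) b).differentiableAt_of_isOpen hU (n := 0) (hsU x)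
  have hi : DifferentiableAt ℝ (fun q : Spacetime => q.1⁻¹) (hypPt s x) :=
    differentiableAt_fst.inv ht.ne'
  rw [h1, dirDeriv_comp_hypPt hs (f := fun p : Spacetime => p.1⁻¹ • boost b f p) (hi.smul hb),
    boost_smul hi hb, boost_inv_fst ht.ne']
  simp only [smul_add, smul_sub, smul_smul]
  rw [sub_eq_neg_add, ← neg_smul]
  congr 2
  · change _ * -(x a * _) = _
    field_simp
  · ring

/-- Klainerman-Sobolev inequality on hyperboloids in integral form. -/
theorem norm_sq_le_integral_boost {E : Type*} [NormedAddCommGroup E] [InnerProductSpace ℝ E]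
    {s : ℝ} (hs : 0 < s) (hU : IsOpen U)
    (hsU : ∀ x, hypPt s x ∈ U) {f : Spacetime → E}
    (hf : ContDiffOn ℝ ((2 : ℕ) : WithTop ℕ∞) f U) {R : ℝ}
    (hR : ∀ x : Space2, R < ‖x‖ → f (hypPt s x) = 0) (x : Space2) :
    ‖f (hypPt s x)‖ ^ 2 ≤ ∫ y, ((hypPt s y).1⁻¹) ^ 2 *
      |2 * inner ℝ (boost 0 f (hypPt s y)) (boost 1 f (hypPt s y))
        + 2 * inner ℝ (f (hypPt s y)) (boost 0 (boost 1 f) (hypPt s y))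
        - (y 0 / (hypPt s y).1) * (2 * inner ℝ (f (hypPt s y)) (boost 1 f (hypPt s y)))| := by
  have hd {p} (hp : p ∈ U) : DifferentiableAt ℝ f p :=
    hf.differentiableAt_of_isOpen hU (n := 1) hp
  have hbd {p} (hp : p ∈ U) : DifferentiableAt ℝ (boost 1 f) p :=
    (hf.boost hU (n := 1) 1).differentiableAt_of_isOpen hU (n := 0) hp
  -- The plane estimate is applied to `|f|²`: its second derivatives are bilinear in `f` and its
  -- boosts, and the factor `t⁻²` splits evenly between the two factors, ready for `L²` norms.
  set H : Spacetime → ℝ := fun p => inner ℝ (f p) (f p) with hH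
  have hHc : ContDiffOn ℝ ((2 : ℕ) : WithTop ℕ∞) H U := hf.inner ℝ hf
  have hc : ContDiff ℝ 2 (fun y => H (hypPt s y)) := by
    rw [← contDiffOn_univ]
    exact hHc.comp (contDiff_hypPt hs).contDiffOn fun y _ => hsU y
  have hcs : HasCompactSupport (fun y => H (hypPt s y)) := by
    refine HasCompactSupport.intro (isCompact_closedBall (0 : Space2) R) fun y hy => ?_
    rw [mem_closedBall_zero_iff, not_le] at hy
    simp [hH, hR y hy]
  have key := abs_le_integral_dirDeriv_dirDeriv hc hcs x
  have e1 : |H (hypPt s x)| = ‖f (hypPt s x)‖ ^ 2 := by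
    simp only [hH, real_inner_self_eq_norm_sq]
    exact abs_of_nonneg (by positivity)
  rw [e1] at key
  refine key.trans_eq (integral_congr_ae (Filter.Eventually.of_forall fun y => ?_))
  have e2 : Set.EqOn (boost 1 H) (fun p => 2 • inner ℝ (f p) (boost 1 f p)) U := by
    intro p hp
    rw [hH, boost_norm_sq (hd hp) (hd hp), real_inner_comm]
    simp [two_mul]
  have e3 : boost 0 (boost 1 H) (hypPt s y) =
      2 * (inner ℝ (boost 0 f (hypPt s y)) (boost 1 f (hypPt s y))
        + inner ℝ (f (hypPt s y)) (boost 0 (boost 1 f) (hypPt s y))) := by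
    rw [e2.boost hU 0 (hsU y)]
    have := boost_clm ((2 : ℝ) • ContinuousLinearMap.id ℝ ℝ)
      ((hd (hsU y)).inner ℝ (hbd (hsU y))) 0
    rw [boost_norm_sq (hd (hsU y)) (hbd (hsU y))] at this
    simpa using this
  simp only
  rw [dirDeriv_dirDeriv_comp_hypPt hs hU hsU hHc, e3, e2 (hsU y), smul_eq_mul, abs_mul,
    abs_of_nonneg (by positivity : (0 : ℝ) ≤ ((hypPt s y).1⁻¹) ^ 2)]
  simp only [smul_eq_mul, nsmul_eq_mul, Nat.cast_ofNat]
  ring_nf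

end HyperboloidSobolev
end

noncomputable section

/-! ### Dirac matrices, commutation with the Dirac operator, and coercivity of the energies. -/

section DiracMatrices

theorem matAct_mul (A B : Matrix (Fin 2) (Fin 2) ℂ) (w : Spinor) :
    matAct (A * B) w = matAct A (matAct B w) := by
  simp only [matAct, Matrix.mulVec_mulVec]

/-- A matrix acting on spinors, as a real continuous linear map. -/
def matCLM (A : Matrix (Fin 2) (Fin 2) ℂ) : Spinor →L[ℝ] Spinor :=
  (Matrix.toEuclideanCLM (n := Fin 2) (𝕜 := ℂ) A).restrictScalars ℝ

theorem matCLM_apply (A : Matrix (Fin 2) (Fin 2) ℂ) (w : Spinor) : matCLM A w = matAct A w := rfl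

theorem matCLM_smul_complex (A : Matrix (Fin 2) (Fin 2) ℂ) (c : ℂ) (w : Spinor) :
    matCLM A (c • w) = c • matCLM A w :=
  map_smul (Matrix.toEuclideanCLM (n := Fin 2) (𝕜 := ℂ) A) c w

theorem sesq_eq_inner (w z : Spinor) (A : Matrix (Fin 2) (Fin 2) ℂ) :
    sesq w A z = inner ℂ w (matAct A z) := by
  rw [EuclideanSpace.inner_eq_star_dotProduct, sesq, dotProduct_comm]
  rfl

theorem inner_matAct (A : Matrix (Fin 2) (Fin 2) ℂ) (w z : Spinor) :
    inner ℂ (matAct A w) z = inner ℂ w (matAct Aᴴ z) := by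
  simp only [EuclideanSpace.inner_eq_star_dotProduct, matAct]
  rw [Matrix.star_mulVec, dotProduct_comm, ← Matrix.dotProduct_mulVec, dotProduct_comm]

/-- The Minkowski metric with real entries. -/
def minkowskiReal (μ ν : Fin 3) : ℝ := if μ = ν then (if μ = 0 then -1 else 1) else 0

theorem minkowski_eq (μ ν : Fin 3) : minkowski μ ν = (minkowskiReal μ ν : ℂ) := by
  unfold minkowski minkowskiReal
  split_ifs <;> simp

theorem coordDir_fst (μ : Fin 3) : (coordDir μ).1 = -minkowskiReal μ 0 := by
  refine Fin.cases ?_ (fun b => ?_) μ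
  · simp [coordDir_zero, minkowskiReal]
  · simp [coordDir_succ, minkowskiReal, Fin.succ_ne_zero]

theorem coordDir_snd (μ : Fin 3) (a : Fin 2) : (coordDir μ).2 a = minkowskiReal μ a.succ := by
  refine Fin.cases ?_ (fun b => ?_) μ
  · simp [coordDir_zero, minkowskiReal, (Fin.succ_ne_zero a).symm]
  · simp only [coordDir_succ, minkowskiReal, Fin.succ_ne_zero, Fin.succ_inj, if_false]
    simp [eq_comm]

variable {γ : Fin 3 → Matrix (Fin 2) (Fin 2) ℂ}

namespace IsDiracMatrices

theorem anticomm (hγ : IsDiracMatrices γ) (μ ν : Fin 3) (w : Spinor) :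
    matCLM (γ μ) (matCLM (γ ν) w) =
      -matCLM (γ ν) (matCLM (γ μ) w) - (2 * minkowskiReal μ ν) • w := by
  have h := congrArg (fun A => matAct A w) (hγ.clifford μ ν)
  have e1 : matAct (γ μ * γ ν + γ ν * γ μ) w =
      matAct (γ μ) (matAct (γ ν) w) + matAct (γ ν) (matAct (γ μ) w) := by
    rw [← matAct_mul, ← matAct_mul]
    simp only [matAct, Matrix.add_mulVec, WithLp.toLp_add]
  have e2 : matAct ((-2 * minkowski μ ν) • (1 : Matrix (Fin 2) (Fin 2) ℂ)) w =
      -((2 * minkowskiReal μ ν) • w) := by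
    ext i
    fin_cases i <;> simp [matAct, minkowski_eq]
  simp only [e1, e2] at h
  simp only [matCLM_apply]
  rw [eq_sub_iff_add_eq, eq_neg_iff_add_eq_zero]
  rw [← neg_eq_iff_eq_neg.mpr h]
  abel

theorem sq_zero (hγ : IsDiracMatrices γ) (w : Spinor) :
    matCLM (γ 0) (matCLM (γ 0) w) = w := by
  have h := hγ.anticomm 0 0 w
  simp only [minkowskiReal, if_true] at h
  rw [eq_sub_iff_add_eq, eq_neg_iff_add_eq_zero] at h
  have h2 : (2 : ℝ) • (matCLM (γ 0) (matCLM (γ 0) w) - w) = 0 := by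
    rw [← h]
    module
  exact sub_eq_zero.1 ((smul_eq_zero.1 h2).resolve_left two_ne_zero)

theorem sq_succ (hγ : IsDiracMatrices γ) (a : Fin 2) (w : Spinor) :
    matCLM (γ a.succ) (matCLM (γ a.succ) w) = -w := by
  have h := hγ.anticomm a.succ a.succ w
  simp only [minkowskiReal, if_true, Fin.succ_ne_zero, if_false] at h
  rw [eq_sub_iff_add_eq, eq_neg_iff_add_eq_zero] at h
  have h2 : (2 : ℝ) • (matCLM (γ a.succ) (matCLM (γ a.succ) w) + w) = 0 := by
    rw [← h]
    module
  exact eq_neg_of_add_eq_zero_left ((smul_eq_zero.1 h2).resolve_left two_ne_zero)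

theorem anticomm_of_ne (hγ : IsDiracMatrices γ) {μ ν : Fin 3} (h : μ ≠ ν) (w : Spinor) :
    matCLM (γ μ) (matCLM (γ ν) w) = -matCLM (γ ν) (matCLM (γ μ) w) := by
  simp [hγ.anticomm μ ν w, minkowskiReal, h]

/-- The sign in the adjoint relation equals the sign of the square of `γ^μ`, so every `γ^μ` is
unitary. -/
theorem adjoint_mul_self (hγ : IsDiracMatrices γ) (μ : Fin 3) : (γ μ)ᴴ * γ μ = 1 := by
  have h := hγ.clifford μ μ
  have h2 : γ μ * γ μ = (-minkowski μ μ) • (1 : Matrix (Fin 2) (Fin 2) ℂ) := by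
    have : (2 : ℂ) • (γ μ * γ μ) = (2 : ℂ) • ((-minkowski μ μ) • 1) := by
      rw [two_smul, h, smul_smul]
      congr 1
      ring
    exact smul_right_injective _ two_ne_zero this
  have h3 : ∑ ν, minkowski μ ν • γ ν = minkowski μ μ • γ μ :=
    Finset.sum_eq_single μ (fun ν _ hν => by simp [minkowski, hν.symm]) (by simp)
  rw [hγ.adjoint, h3, neg_mul, Matrix.smul_mul, h2, smul_smul, ← neg_smul]
  by_cases h0 : μ = 0 <;> simp [minkowski, h0]

theorem norm_matCLM (hγ : IsDiracMatrices γ) (μ : Fin 3) (w : Spinor) :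
    ‖matCLM (γ μ) w‖ = ‖w‖ := by
  have h : inner ℂ (matAct (γ μ) w) (matAct (γ μ) w) = inner ℂ w w := by
    rw [inner_matAct, ← matAct_mul, hγ.adjoint_mul_self]
    simp [matAct]
  rw [inner_self_eq_norm_sq_to_K, inner_self_eq_norm_sq_to_K] at h
  have h2 : ‖matAct (γ μ) w‖ ^ 2 = ‖w‖ ^ 2 := by exact_mod_cast h
  exact (sq_eq_sq₀ (norm_nonneg _) (norm_nonneg _)).1 h2

end IsDiracMatrices

/-- The spinorial correction of the boosts. -/
def spinBoost (γ : Fin 3 → Matrix (Fin 2) (Fin 2) ℂ) (a : Fin 2) : Spinor →L[ℝ] Spinor :=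
  (1 / 2 : ℝ) • matCLM (γ 0 * γ a.succ)

theorem spinBoost_apply (a : Fin 2) (w : Spinor) :
    spinBoost γ a w = (1 / 2 : ℝ) • matCLM (γ 0) (matCLM (γ a.succ) w) := by
  simp only [spinBoost, smul_apply, matCLM_apply, matAct_mul]

theorem norm_spinBoost_le (hγ : IsDiracMatrices γ) (a : Fin 2) : ‖spinBoost γ a‖ ≤ 1 := by
  refine ContinuousLinearMap.opNorm_le_bound _ zero_le_one fun w => ?_
  rw [spinBoost_apply, norm_smul, hγ.norm_matCLM, hγ.norm_matCLM, Real.norm_eq_abs]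
  have := norm_nonneg w
  rw [abs_of_pos (by norm_num)]
  linarith

theorem modBoostIter_eq (I : List (Fin 3)) (J : List (Fin 2)) (Ψ : Spacetime → Spinor) :
    pdIter I (modBoostIter γ J Ψ) = opIter (spinBoost γ) I J Ψ := rfl

theorem boostIter_eq {E : Type*} [NormedAddCommGroup E] [NormedSpace ℝ E] (I : List (Fin 3))
    (J : List (Fin 2)) (φ : Spacetime → E) :
    pdIter I (boostIter J φ) = opIter 0 I J φ := by
  have : opBoost (0 : Fin 2 → E →L[ℝ] E) = boost := by
    funext a φ p
    simp [opBoost]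
  simp only [opIter, this, boostIter]

variable {U : Set Spacetime} {Φ : Spacetime → Spinor} {p : Spacetime}

theorem diracOp_eq (Φ : Spacetime → Spinor) (p : Spacetime) :
    diracOp γ Φ p = ∑ μ : Fin 3, Complex.I • matCLM (γ μ) (pd μ Φ p) := by
  rw [← Finset.smul_sum]
  rfl

/-- The operator `i γ^μ`. -/
def iGamma (γ : Fin 3 → Matrix (Fin 2) (Fin 2) ℂ) (μ : Fin 3) : Spinor →L[ℝ] Spinor :=
  (Complex.I • Matrix.toEuclideanCLM (n := Fin 2) (𝕜 := ℂ) (γ μ)).restrictScalars ℝ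

theorem diracOp_eq_fun (Φ : Spacetime → Spinor) :
    diracOp γ Φ = fun p => iGamma γ 0 (pd 0 Φ p) + iGamma γ 1 (pd 1 Φ p)
      + iGamma γ 2 (pd 2 Φ p) := by
  funext p
  rw [diracOp_eq, Fin.sum_univ_three]
  rfl

theorem ContDiffOn.diracOp {n : ℕ} (hU : IsOpen U)
    (h : ContDiffOn ℝ ((n + 1 : ℕ) : WithTop ℕ∞) Φ U) :
    ContDiffOn ℝ (n : WithTop ℕ∞) (diracOp γ Φ) U := by
  rw [diracOp_eq_fun]
  have (μ : Fin 3) := (iGamma γ μ).contDiff.comp_contDiffOn (h.pd hU μ)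
  exact ((this 0).add (this 1)).add (this 2)

theorem pd_diracOp (hU : IsOpen U) (h : ContDiffOn ℝ ((2 : ℕ) : WithTop ℕ∞) Φ U) (hp : p ∈ U)
    (α : Fin 3) : pd α (diracOp γ Φ) p = diracOp γ (pd α Φ) p := by
  have hd (μ : Fin 3) : DifferentiableAt ℝ (pd μ Φ) p :=
    (h.pd (n := 1) hU μ).differentiableAt_of_isOpen hU (n := 0) hp
  have hd' (μ : Fin 3) : DifferentiableAt ℝ (fun q => iGamma γ μ (pd μ Φ q)) p :=
    (iGamma γ μ).differentiableAt.comp p (hd μ)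
  simp only [diracOp_eq_fun]
  rw [pd_add ((hd' 0).fun_add (hd' 1)) (hd' 2), pd_add (hd' 0) (hd' 1)]
  simp only [pd_clm _ (hd _), pd_comm hU h hp α]

theorem boost_diracOp (hU : IsOpen U) (h : ContDiffOn ℝ ((2 : ℕ) : WithTop ℕ∞) Φ U) (hp : p ∈ U)
    (a : Fin 2) : boost a (diracOp γ Φ) p = ∑ μ, Complex.I • matCLM (γ μ) (boost a (pd μ Φ) p) := by
  have hd (μ : Fin 3) : DifferentiableAt ℝ (pd μ Φ) p :=
    (h.pd (n := 1) hU μ).differentiableAt_of_isOpen hU (n := 0) hp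
  have hd' (μ : Fin 3) : DifferentiableAt ℝ (fun q => iGamma γ μ (pd μ Φ q)) p :=
    (iGamma γ μ).differentiableAt.comp p (hd μ)
  rw [diracOp_eq_fun, boost_add ((hd' 0).fun_add (hd' 1)) (hd' 2), boost_add (hd' 0) (hd' 1),
    Fin.sum_univ_three]
  simp only [boost_clm _ (hd _)]
  rfl

/-- The corrected boosts commute with the Dirac operator. -/
theorem opBoost_diracOp (hγ : IsDiracMatrices γ) (hU : IsOpen U)
    (h : ContDiffOn ℝ ((2 : ℕ) : WithTop ℕ∞) Φ U) (hp : p ∈ U) (a : Fin 2) :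
    opBoost (spinBoost γ) a (diracOp γ Φ) p = diracOp γ (opBoost (spinBoost γ) a Φ) p := by
  have hΦ : DifferentiableAt ℝ Φ p := h.differentiableAt_of_isOpen hU (n := 1) hp
  have hb : DifferentiableAt ℝ (boost a Φ) p :=
    (h.boost hU (n := 1) a).differentiableAt_of_isOpen hU (n := 0) hp
  have key (μ : Fin 3) : pd μ (opBoost (spinBoost γ) a Φ) p =
      boost a (pd μ Φ) p + ((coordDir μ).1 • pd a.succ Φ p + (coordDir μ).2 a • pd 0 Φ p)
        - spinBoost γ a (pd μ Φ p) := by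
    have h1 : opBoost (spinBoost γ) a Φ = fun q => boost a Φ q + (-(spinBoost γ a)) (Φ q) := by
      funext q
      simp [opBoost, sub_eq_add_neg]
    rw [h1, pd_add (g := fun q => (-(spinBoost γ a)) (Φ q)) hb
      ((-(spinBoost γ a)).differentiableAt.comp p hΦ), pd_clm _ hΦ,
      pd_boost hU h hp]
    simp [sub_eq_add_neg]
  simp only [opBoost, boost_diracOp hU h hp]
  rw [diracOp_eq, diracOp_eq]
  simp only [← Finset.smul_sum, key]
  have hI : spinBoost γ a (Complex.I • ∑ μ, matCLM (γ μ) (pd μ Φ p)) =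
      Complex.I • spinBoost γ a (∑ μ, matCLM (γ μ) (pd μ Φ p)) := by
    simp only [spinBoost_apply, matCLM_smul_complex]
    rw [smul_comm]
  rw [hI, ← smul_sub]
  congr 1
  -- The commutator of `½γ⁰γ^a` with `γ^μ` is `η^{μ0}γ^a - η^{μa}γ⁰`. Summed against `∂_μΦ` it
  -- cancels the terms `γ⁰∂_aΦ + γ^a∂_tΦ` produced by the commutators of `∂_μ` with `L_a`; this
  -- fixes the coefficient `½`.
  have hcomm (μ : Fin 3) (w : Spinor) : spinBoost γ a (matCLM (γ μ) w) =
      matCLM (γ μ) (spinBoost γ a w) + (minkowskiReal μ 0 • matCLM (γ a.succ) w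
        - minkowskiReal μ a.succ • matCLM (γ 0) w) := by
    simp only [spinBoost_apply, map_smul]
    rw [hγ.anticomm μ 0, hγ.anticomm μ a.succ]
    simp only [map_sub, map_neg, map_smul]
    module
  simp only [map_add, map_sub, map_sum, hcomm, map_smul, coordDir_fst, coordDir_snd,
    Finset.sum_add_distrib, Finset.sum_sub_distrib]
  have s1 (w : Fin 3 → Spinor) : ∑ μ, minkowskiReal μ 0 • w μ = -w 0 := by
    simp [minkowskiReal]
  have s2 (w : Fin 3 → Spinor) : ∑ μ, minkowskiReal μ a.succ • w μ = w a.succ := by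
    rw [Finset.sum_eq_single a.succ (fun ν _ hν => by simp [minkowskiReal, hν]) (by simp)]
    simp [minkowskiReal, Fin.succ_ne_zero]
  rw [s1 (fun μ => matCLM (γ a.succ) (pd μ Φ p)), s2 (fun μ => matCLM (γ 0) (pd μ Φ p))]
  simp only [neg_smul, Finset.sum_neg_distrib]
  rw [s1 (fun μ => matCLM (γ μ) (pd a.succ Φ p)), s2 (fun μ => matCLM (γ μ) (pd 0 Φ p))]
  abel

theorem opIter_diracOp (hγ : IsDiracMatrices γ) (hU : IsOpen U) (I : List (Fin 3))
    (J : List (Fin 2))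
    (h : ContDiffOn ℝ ((I.length + J.length + 1 : ℕ) : WithTop ℕ∞) Φ U) :
    Set.EqOn (opIter (spinBoost γ) I J (diracOp γ Φ))
      (diracOp γ (opIter (spinBoost γ) I J Φ)) U := by
  induction I with
  | nil =>
    induction J with
    | nil => intro p _; rfl
    | cons a J ih =>
      simp only [List.length_cons, List.length_nil, zero_add] at h ih
      have ih' := ih (h.of_le (by norm_cast; omega))
      intro p hp
      rw [opIter_nil_cons, ih'.opBoost hU a hp, opIter_nil_cons]
      refine opBoost_diracOp hγ hU ?_ hp a
      exact ContDiffOn.opIter hU [] J (h.of_le (by simp; norm_cast; omega))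
  | cons α I ih =>
    simp only [List.length_cons] at h ih
    have ih' := ih (h.of_le (by norm_cast; omega))
    intro p hp
    rw [opIter_cons, ih'.pd hU α hp, opIter_cons]
    refine pd_diracOp hU ?_ hp α
    exact ContDiffOn.opIter hU I J (h.of_le (by norm_cast; omega))

/-- The gradient of a spinor near the light cone is controlled by boosts and the Dirac operator. -/
theorem coneDist_mul_norm_pd_le (hγ : IsDiracMatrices γ) (hp : ‖p.2‖ < p.1) (α : Fin 3) :
    (p.1 - ‖p.2‖) * ‖pd α Φ p‖ ≤
      4 * (‖boost 0 Φ p‖ + ‖boost 1 Φ p‖ + p.1 * ‖diracOp γ Φ p‖) := by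
  obtain ⟨t, x⟩ := p
  simp only at hp ⊢
  have hx := norm_nonneg x
  have ht : 0 < t := hx.trans_lt hp
  set w := pd 0 Φ (t, x) with hw
  set l := fun a : Fin 2 => boost a Φ (t, x) with hl
  have hla (a : Fin 2) : t • pd a.succ Φ (t, x) = l a - x a • w := by
    simp [hl, boost, hw]
  set A := fun μ => matCLM (γ μ) with hA
  set G : Spinor → Spinor := fun u => t • A 0 u - (x 0 • A 1 u + x 1 • A 2 u) with hG
  have hnx : ‖x‖ ^ 2 = x 0 ^ 2 + x 1 ^ 2 := by
    rw [EuclideanSpace.norm_sq_eq, Fin.sum_univ_two, Real.norm_eq_abs, Real.norm_eq_abs, sq_abs,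
      sq_abs]
  have hx0 : |x 0| ≤ t := (abs_le_of_sq_le_sq (by nlinarith [sq_nonneg (x 1)]) hx).trans hp.le
  have hx1 : |x 1| ≤ t := (abs_le_of_sq_le_sq (by nlinarith [sq_nonneg (x 0)]) hx).trans hp.le
  -- By the Clifford relations the cross terms cancel, `γ⁰` squares to 1 and `γ^a` to -1. So `G` is
  -- invertible inside the cone, degenerating only at its boundary.
  have hGG (u : Spinor) : G (G u) = (t ^ 2 - ‖x‖ ^ 2) • u := by
    have r0 := hγ.sq_zero
    have r1 := hγ.sq_succ 0
    have r2 := hγ.sq_succ 1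
    have r01 := hγ.anticomm_of_ne (μ := 1) (ν := 0) (by decide)
    have r02 := hγ.anticomm_of_ne (μ := 2) (ν := 0) (by decide)
    have r12 := hγ.anticomm_of_ne (μ := 2) (ν := 1) (by decide)
    simp only [Fin.succ_zero_eq_one, Fin.succ_one_eq_two] at r1 r2
    simp only [hG, hA, map_sub, map_add, map_smul, r0, r1, r2, r01, r02, r12, hnx]
    module
  have hGn (u : Spinor) : ‖G u‖ ≤ 3 * t * ‖u‖ := by
    have n0 : ‖t • A 0 u‖ ≤ t * ‖u‖ := by
      rw [norm_smul, hγ.norm_matCLM, Real.norm_eq_abs, abs_of_pos ht]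
    have n1 : ‖x 0 • A 1 u‖ ≤ t * ‖u‖ := by
      rw [norm_smul, hγ.norm_matCLM, Real.norm_eq_abs]
      gcongr
    have n2 : ‖x 1 • A 2 u‖ ≤ t * ‖u‖ := by
      rw [norm_smul, hγ.norm_matCLM, Real.norm_eq_abs]
      gcongr
    have := norm_sub_le (t • A 0 u) (x 0 • A 1 u + x 1 • A 2 u)
    have := norm_add_le (x 0 • A 1 u) (x 1 • A 2 u)
    simp only [hG]
    linarith
  have hD : G w = -(t • Complex.I • diracOp γ Φ (t, x)) - (A 1 (l 0) + A 2 (l 1)) := by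
    have e0 : Complex.I • diracOp γ Φ (t, x) =
        -(A 0 w + A 1 (pd 1 Φ (t, x)) + A 2 (pd 2 Φ (t, x))) := by
      rw [diracOp_eq, Fin.sum_univ_three, ← smul_add, ← smul_add, smul_smul, Complex.I_mul_I,
        neg_one_smul]
    have h0 := congrArg (A 1) (hla 0)
    have h1 := congrArg (A 2) (hla 1)
    simp only [Fin.succ_zero_eq_one, Fin.succ_one_eq_two, map_sub, map_smul] at h0 h1
    rw [e0]
    simp only [smul_neg, smul_add, h0, h1, hG]
    abel
  have hw1 : (t - ‖x‖) * ‖w‖ ≤ 3 * (‖l 0‖ + ‖l 1‖ + t * ‖diracOp γ Φ (t, x)‖) := by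
    have e1 : ‖G w‖ ≤ t * ‖diracOp γ Φ (t, x)‖ + (‖l 0‖ + ‖l 1‖) := by
      rw [hD]
      refine (norm_sub_le _ _).trans (add_le_add ?_ ?_)
      · rw [norm_neg, norm_smul, norm_smul, Complex.norm_I, one_mul, Real.norm_eq_abs,
          abs_of_pos ht]
      · refine (norm_add_le _ _).trans_eq ?_
        rw [hγ.norm_matCLM, hγ.norm_matCLM]
    have e2 : (t ^ 2 - ‖x‖ ^ 2) * ‖w‖ ≤ 3 * t * ‖G w‖ := by
      have := hGn (G w)
      rwa [hGG, norm_smul, Real.norm_eq_abs, abs_of_pos (by nlinarith)] at this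
    -- Here `t² - r² = (t + r)(t - r) ≥ t(t - r)`, so one factor `t` can be divided out.
    have e3 : t * ((t - ‖x‖) * ‖w‖) ≤ t * (3 * ‖G w‖) := by
      have h5 : 0 ≤ (t - ‖x‖) * ‖w‖ := mul_nonneg (by linarith) (norm_nonneg w)
      nlinarith [mul_nonneg hx h5]
    have := le_of_mul_le_mul_left e3 ht
    linarith
  have hl0 := norm_nonneg (l 0)
  have hl1 := norm_nonneg (l 1)
  have hDn : 0 ≤ t * ‖diracOp γ Φ (t, x)‖ := by positivity
  refine Fin.cases ?_ (fun a => ?_) α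
  · change (t - ‖x‖) * ‖w‖ ≤ 4 * (‖l 0‖ + ‖l 1‖ + t * ‖diracOp γ Φ (t, x)‖)
    linarith
  · have hxa : |x a| ≤ t := by
      fin_cases a
      · exact hx0
      · exact hx1
    have e4 : t * ‖pd a.succ Φ (t, x)‖ ≤ ‖l a‖ + t * ‖w‖ := by
      have := norm_sub_le (l a) (x a • w)
      rw [← hla, norm_smul, norm_smul, Real.norm_eq_abs, Real.norm_eq_abs, abs_of_pos ht] at this
      refine this.trans ?_
      gcongr
    have e5 : ‖l a‖ ≤ ‖l 0‖ + ‖l 1‖ := by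
      fin_cases a
      · exact le_add_of_nonneg_right hl1
      · exact le_add_of_nonneg_left hl0
    have e6 : t * ((t - ‖x‖) * ‖pd a.succ Φ (t, x)‖) ≤
        t * (4 * (‖l 0‖ + ‖l 1‖ + t * ‖diracOp γ Φ (t, x)‖)) := by
      have h7 := mul_le_mul_of_nonneg_left e4 (by linarith : 0 ≤ t - ‖x‖)
      have h8 : (t - ‖x‖) * ‖l a‖ ≤ t * (‖l 0‖ + ‖l 1‖) :=
        mul_le_mul (by linarith) e5 (norm_nonneg _) ht.le
      have h9 := mul_le_mul_of_nonneg_left hw1 ht.le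
      nlinarith [mul_nonneg ht.le hDn]
    exact le_of_mul_le_mul_left e6 ht

/-- Coercivity of the Dirac energy density. -/
theorem energyDirac_density_ge (hγ : IsDiracMatrices γ) {s : ℝ} (hs : 0 < s) (x : Space2)
    (w : Spinor) :
    ‖(s / (hypPt s x).1) • w‖ ^ 2 ≤ 2 * (‖w‖ ^ 2
      - ∑ a : Fin 2, x a / (hypPt s x).1 * (sesq w (γ 0 * γ a.succ) w).re) := by
  have ht := hypPt_fst_pos hs x
  have htx := norm_lt_hypPt_fst hs x
  have hts := hypPt_fst_sq s x
  set t := (hypPt s x).1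
  set y := fun a : Fin 2 => x a / t with hy
  set A := fun μ => matCLM (γ μ) with hA
  set r := ‖x‖ / t with hr
  have hr0 : 0 ≤ r := by positivity
  have hr1 : r < 1 := (div_lt_one ht).2 htx
  have hry : r ^ 2 = y 0 ^ 2 + y 1 ^ 2 := by
    simp only [hr, hy, div_pow]
    rw [EuclideanSpace.norm_sq_eq, Fin.sum_univ_two, Real.norm_eq_abs, Real.norm_eq_abs, sq_abs,
      sq_abs, add_div]
  have hst : (s / t) ^ 2 = 1 - r ^ 2 := by
    simp only [hr, div_pow]
    field_simp
    linarith
  have hsesq : ∑ a : Fin 2, x a / t * (sesq w (γ 0 * γ a.succ) w).re =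
      inner ℝ w (A 0 (y 0 • A 1 w + y 1 • A 2 w)) := by
    simp only [map_add, map_smul, inner_add_right, inner_smul_right, Fin.sum_univ_two,
      sesq_eq_inner, matAct_mul]
    rfl
  -- Polarization: `γ¹w + γ²w` and `γ¹w - γ²w` have the same norm, as is seen by applying the
  -- isometries `γ¹` and `γ²` to them. Orthogonality makes the norm of `(x_a/t)γ^a w` exactly
  -- `(r/t)|w|`, so the energy density is at least `(1 - r/t)|w|²`.
  have horth : inner ℝ (A 1 w) (A 2 w) = 0 := by
    have r1 := hγ.sq_succ 0 w
    have r2 := hγ.sq_succ 1 w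
    have r12 := hγ.anticomm_of_ne (μ := 2) (ν := 1) (by decide) w
    simp only [Fin.succ_zero_eq_one, Fin.succ_one_eq_two] at r1 r2
    have n1 : ‖A 1 w + A 2 w‖ = ‖A 1 (A 2 w) - w‖ := by
      rw [← hγ.norm_matCLM 1, map_add, r1]
      congr 1
      abel
    have n2 : ‖A 1 w - A 2 w‖ = ‖A 1 (A 2 w) - w‖ := by
      rw [← hγ.norm_matCLM 2, map_sub, r2, ← norm_neg, r12]
      congr 1
      simp only [hA]
      abel
    have e1 := norm_add_sq_real (A 1 w) (A 2 w)
    have e2 := norm_sub_sq_real (A 1 w) (A 2 w)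
    rw [n1] at e1
    rw [n2] at e2
    linarith
  have hB : ‖y 0 • A 1 w + y 1 • A 2 w‖ = r * ‖w‖ := by
    refine (sq_eq_sq₀ (norm_nonneg _) (by positivity)).1 ?_
    rw [norm_add_sq_real, inner_smul_left, inner_smul_right, horth, norm_smul, norm_smul,
      hγ.norm_matCLM, hγ.norm_matCLM, mul_pow, mul_pow, mul_pow, hry, Real.norm_eq_abs,
      Real.norm_eq_abs, sq_abs, sq_abs]
    ring
  have hin : inner ℝ w (A 0 (y 0 • A 1 w + y 1 • A 2 w)) ≤ r * ‖w‖ ^ 2 := by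
    refine (real_inner_le_norm _ _).trans_eq ?_
    rw [hγ.norm_matCLM, hB]
    ring
  rw [hsesq, norm_smul, mul_pow, Real.norm_eq_abs, sq_abs, hst]
  -- With `r` now standing for `|x|/t`, the claim is `1 - r² ≤ 2(1 - r)`, that is `(1 - r)² ≥ 0`.
  nlinarith [sq_nonneg ‖w‖, mul_nonneg (sq_nonneg (1 - r)) (sq_nonneg ‖w‖)]

/-- Coercivity of the Klein-Gordon energy density. -/
theorem energyKG_density_ge {s : ℝ} (hs : 0 < s) (x : Space2) (φ : Spacetime → ℝ) :
    ‖φ (hypPt s x)‖ ^ 2 ≤ (∑ α : Fin 3, pd α φ (hypPt s x) ^ 2)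
      + (∑ a : Fin 2, x a / (hypPt s x).1 *
          (2 * (pd 0 φ (hypPt s x) * pd a.succ φ (hypPt s x))))
      + 1 ^ 2 * φ (hypPt s x) ^ 2 := by
  have ht := hypPt_fst_pos hs x
  have hts := hypPt_fst_sq s x
  have hnx : ‖x‖ ^ 2 = x 0 ^ 2 + x 1 ^ 2 := by
    rw [EuclideanSpace.norm_sq_eq, Fin.sum_univ_two, Real.norm_eq_abs, Real.norm_eq_abs, sq_abs,
      sq_abs]
  set t := (hypPt s x).1
  have hy : (x 0 / t) ^ 2 + (x 1 / t) ^ 2 ≤ 1 := by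
    rw [div_pow, div_pow, ← add_div, ← hnx, div_le_one (by positivity), hts]
    nlinarith
  simp only [Fin.sum_univ_three, Fin.sum_univ_two, Fin.succ_zero_eq_one, Fin.succ_one_eq_two,
    Real.norm_eq_abs, sq_abs]
  have h0 := mul_le_mul_of_nonneg_right hy (sq_nonneg (pd 0 φ (hypPt s x)))
  -- The density is `∑_a (∂_aφ + (x_a/t)∂_tφ)² + (1 - r²/t²)(∂_tφ)² + φ²`.
  nlinarith [sq_nonneg (pd 1 φ (hypPt s x) + x 0 / t * pd 0 φ (hypPt s x)),
    sq_nonneg (pd 2 φ (hypPt s x) + x 1 / t * pd 0 φ (hypPt s x))]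

end DiracMatrices
end

noncomputable section

/-! ### Quantitative square integrability on the plane. -/

section SquareIntegrable

variable {E F : Type*} [NormedAddCommGroup E] [NormedAddCommGroup F] {f g : Space2 → E} {c d : ℝ}

/-- The `L²` norm of `f` is at most `c`. -/
structure L2Le (f : Space2 → E) (c : ℝ) : Prop where
  nonneg : 0 ≤ c
  aesm : AEStronglyMeasurable f volume
  le : eLpNorm f 2 volume ≤ ENNReal.ofReal c

namespace L2Le

theorem mono (h : L2Le f c) (hcd : c ≤ d) : L2Le f d :=
  ⟨h.nonneg.trans hcd, h.aesm, h.le.trans (ENNReal.ofReal_le_ofReal hcd)⟩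

theorem add (hf : L2Le f c) (hg : L2Le g d) : L2Le (fun x => f x + g x) (c + d) := by
  refine ⟨add_nonneg hf.nonneg hg.nonneg, hf.aesm.add hg.aesm, ?_⟩
  rw [ENNReal.ofReal_add hf.nonneg hg.nonneg]
  exact (eLpNorm_add_le hf.aesm hg.aesm (by norm_num)).trans (add_le_add hf.le hg.le)

theorem of_norm_le {g : Space2 → F} (hf : L2Le f c) (hg : AEStronglyMeasurable g volume)
    (h : ∀ x, ‖g x‖ ≤ ‖f x‖) : L2Le g c :=
  ⟨hf.nonneg, hg, (eLpNorm_mono h).trans hf.le⟩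

theorem const_smul [NormedSpace ℝ E] (r : ℝ) (hf : L2Le f c) : L2Le (fun x => r • f x) (|r| * c) := by
  refine ⟨mul_nonneg (abs_nonneg r) hf.nonneg, hf.aesm.const_smul r, ?_⟩
  rw [ENNReal.ofReal_mul (abs_nonneg r)]
  refine (eLpNorm_const_smul_le (c := r)).trans ?_
  rw [← Real.norm_eq_abs, ofReal_norm]
  exact mul_le_mul_right hf.le _

theorem of_norm_le_mul [NormedSpace ℝ E] {g : Space2 → F} {r : ℝ} (hr : 0 ≤ r) (hf : L2Le f c)
    (hg : AEStronglyMeasurable g volume) (h : ∀ x, ‖g x‖ ≤ r * ‖f x‖) : L2Le g (r * c) := by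
  have := (hf.const_smul r).of_norm_le hg fun x => by
    rw [norm_smul, Real.norm_eq_abs, abs_of_nonneg hr]
    exact h x
  rwa [abs_of_nonneg hr] at this

theorem norm (hf : L2Le f c) : L2Le (fun x => ‖f x‖) c :=
  hf.of_norm_le hf.aesm.norm fun x => by simp

theorem memLp (hf : L2Le f c) : MemLp f 2 volume :=
  ⟨hf.aesm, hf.le.trans_lt ENNReal.ofReal_lt_top⟩

theorem integrable_sq (hf : L2Le f c) : Integrable (fun x => ‖f x‖ ^ 2) :=
  hf.memLp.integrable_norm_pow (by norm_num)

theorem integral_sq_le (hf : L2Le f c) : ∫ x, ‖f x‖ ^ 2 ≤ c ^ 2 := by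
  have h := hf.memLp.eLpNorm_eq_integral_rpow_norm (by norm_num) (by norm_num)
  have h2 := hf.le
  have h0 : 0 ≤ ∫ x, ‖f x‖ ^ 2 := integral_nonneg fun x => by positivity
  simp only [ENNReal.toReal_ofNat, Real.rpow_ofNat] at h
  rw [h, ENNReal.ofReal_le_ofReal_iff hf.nonneg, ← one_div, ← Real.sqrt_eq_rpow] at h2
  exact (Real.sqrt_le_left hf.nonneg).1 h2

theorem of_integral_sq_le (hc : 0 ≤ c) (hf : AEStronglyMeasurable f volume)
    (hi : Integrable (fun x => ‖f x‖ ^ 2)) (h : ∫ x, ‖f x‖ ^ 2 ≤ c ^ 2) : L2Le f c := by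
  have hm : MemLp f 2 volume := (memLp_two_iff_integrable_sq_norm hf).2 hi
  refine ⟨hc, hf, ?_⟩
  rw [hm.eLpNorm_eq_integral_rpow_norm (by norm_num) (by norm_num)]
  simp only [ENNReal.toReal_ofNat, Real.rpow_ofNat]
  rw [← one_div, ← Real.sqrt_eq_rpow]
  exact ENNReal.ofReal_le_ofReal ((Real.sqrt_le_left hc).2 h)

end L2Le

end SquareIntegrable

/-! ### From energies to `L²` bounds, and from those to pointwise bounds. -/

section OnHyperboloid

variable {E : Type*} [NormedAddCommGroup E] [NormedSpace ℝ E]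
  {U : Set Spacetime} {s : ℝ} {f : Spacetime → E}

theorem ContinuousOn.comp_hypPt {X : Type*} [TopologicalSpace X] {f : Spacetime → X} (hs : 0 < s) (hsU : ∀ x, hypPt s x ∈ U)
    (hf : ContinuousOn f U) : Continuous fun x => f (hypPt s x) :=
  hf.comp_continuous (contDiff_hypPt hs (n := 0)).continuous hsU

theorem continuous_hypPt_fst (hs : 0 < s) : Continuous fun x => (hypPt s x).1 :=
  continuous_fst.comp (contDiff_hypPt hs (n := 0)).continuous

theorem continuous_div_hypPt_fst (hs : 0 < s) : Continuous fun x => s / (hypPt s x).1 :=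
  continuous_const.div (continuous_hypPt_fst hs) fun x => (hypPt_fst_pos hs x).ne'

theorem continuous_coord_div (hs : 0 < s) (a : Fin 2) :
    Continuous fun x : Space2 => x a / (hypPt s x).1 :=
  Continuous.div (by fun_prop) (continuous_hypPt_fst hs) fun x => (hypPt_fst_pos hs x).ne'

theorem abs_coord_le (x : Space2) (a : Fin 2) : |x a| ≤ ‖x‖ := PiLp.norm_apply_le x a

theorem abs_coord_div_le (hs : 0 < s) (x : Space2) (a : Fin 2) :
    |x a / (hypPt s x).1| ≤ 1 := by
  rw [abs_div, abs_of_pos (hypPt_fst_pos hs x), div_le_one (hypPt_fst_pos hs x)]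
  exact (abs_coord_le x a).trans (norm_lt_hypPt_fst hs x).le

theorem hasCompactSupport_of_ball {α : Type*} [Zero α] {h : Space2 → α} {R : ℝ}
    (hR : ∀ x : Space2, R < ‖x‖ → h x = 0) : HasCompactSupport h := by
  refine HasCompactSupport.intro (isCompact_closedBall (0 : Space2) R) fun y hy => ?_
  rw [mem_closedBall_zero_iff, not_le] at hy
  exact hR y hy

/-- Vanishing outside a ball is essential: the integral of a non-integrable density is 0 by
convention, and then a bound on the energy would say nothing. The factor 2 is a rounding of `√2`. -/
theorem L2Le.of_energyDirac {γ : Fin 3 → Matrix (Fin 2) (Fin 2) ℂ} (hγ : IsDiracMatrices γ)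
    {Ψ : Spacetime → Spinor} (hs : 0 < s) (hsU : ∀ x, hypPt s x ∈ U) (hΨ : ContinuousOn Ψ U)
    {R : ℝ} (hR : ∀ x : Space2, R < ‖x‖ → Ψ (hypPt s x) = 0) {B : ℝ} (hB : 0 ≤ B)
    (hE : Real.sqrt (energyDirac γ s Ψ) ≤ B) :
    L2Le (fun x => (s / (hypPt s x).1) • Ψ (hypPt s x)) (2 * B) := by
  have hc := hΨ.comp_hypPt hs hsU
  have hc' : Continuous fun x => (s / (hypPt s x).1) • Ψ (hypPt s x) :=
    (continuous_div_hypPt_fst hs).smul hc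
  have hi : Integrable (fun x => ‖(s / (hypPt s x).1) • Ψ (hypPt s x)‖ ^ 2) :=
    (hc'.norm.pow 2).integrable_of_hasCompactSupport
      (hasCompactSupport_of_ball (R := R) fun x hx => by simp [hR x hx])
  have hi2 : Integrable (fun x => ‖Ψ (hypPt s x)‖ ^ 2 - ∑ a : Fin 2, x a / (hypPt s x).1 *
      (sesq (Ψ (hypPt s x)) (γ 0 * γ a.succ) (Ψ (hypPt s x))).re) := by
    refine Continuous.integrable_of_hasCompactSupport ?_
      (hasCompactSupport_of_ball (R := R) fun x hx => by simp [hR x hx, sesq])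
    refine (hc.norm.pow 2).sub (continuous_finsetSum _ fun a _ =>
      (continuous_coord_div hs a).mul (Complex.continuous_re.comp ?_))
    simp only [sesq_eq_inner]
    exact hc.inner ((matCLM (γ 0 * γ a.succ)).continuous.comp hc)
  have hEB : energyDirac γ s Ψ ≤ B ^ 2 := (Real.sqrt_le_left hB).1 hE
  refine L2Le.of_integral_sq_le (by positivity) hc'.aestronglyMeasurable hi ?_
  calc _ ≤ ∫ x, 2 * (‖Ψ (hypPt s x)‖ ^ 2 - ∑ a : Fin 2, x a / (hypPt s x).1 *
      (sesq (Ψ (hypPt s x)) (γ 0 * γ a.succ) (Ψ (hypPt s x))).re) :=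
        integral_mono hi (hi2.const_mul 2) fun x => energyDirac_density_ge hγ hs x _
    _ = 2 * energyDirac γ s Ψ := integral_const_mul _ _
    _ ≤ (2 * B) ^ 2 := by nlinarith [sq_nonneg B]

theorem L2Le.of_energyKG {φ : Spacetime → ℝ} (hs : 0 < s) (hU : IsOpen U)
    (hsU : ∀ x, hypPt s x ∈ U) (hφ : ContDiffOn ℝ ((1 : ℕ) : WithTop ℕ∞) φ U)
    {R : ℝ} (hR : ∀ x : Space2, R < ‖x‖ → φ (hypPt s x) = 0)
    (hR' : ∀ (α : Fin 3) (x : Space2), R < ‖x‖ → pd α φ (hypPt s x) = 0) {B : ℝ} (hB : 0 ≤ B)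
    (hE : Real.sqrt (energyKG 1 s φ) ≤ B) :
    L2Le (fun x => φ (hypPt s x)) B := by
  have hc := hφ.continuousOn.comp_hypPt hs hsU
  have hd (α : Fin 3) : Continuous fun x => pd α φ (hypPt s x) :=
    (hφ.pd hU (n := 0) α).continuousOn.comp_hypPt hs hsU
  have hi : Integrable (fun x => ‖φ (hypPt s x)‖ ^ 2) :=
    (hc.norm.pow 2).integrable_of_hasCompactSupport
      (hasCompactSupport_of_ball (R := R) fun x hx => by simp [hR x hx])
  have hEB : energyKG 1 s φ ≤ B ^ 2 := (Real.sqrt_le_left hB).1 hE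
  refine L2Le.of_integral_sq_le hB hc.aestronglyMeasurable hi ?_
  refine (integral_mono hi ?_ fun x => energyKG_density_ge hs x φ).trans hEB
  refine Continuous.integrable_of_hasCompactSupport ?_
    (hasCompactSupport_of_ball (R := R) fun x hx => by simp [hR x hx, hR' _ x hx])
  refine ((continuous_finsetSum _ fun α _ => (hd α).pow 2).add
    (continuous_finsetSum _ fun a _ => (continuous_coord_div hs a).mul
      (continuous_const.mul ((hd 0).mul (hd a.succ))))).add (continuous_const.mul (hc.pow 2))

/-- Klainerman-Sobolev inequality on hyperboloids. -/
theorem norm_le_of_L2Le_boost {E : Type*} [NormedAddCommGroup E] [InnerProductSpace ℝ E]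
    (hs : 0 < s) (hU : IsOpen U) (hsU : ∀ x, hypPt s x ∈ U) {f : Spacetime → E}
    (hf : ContDiffOn ℝ ((2 : ℕ) : WithTop ℕ∞) f U) {R : ℝ}
    (hR : ∀ x : Space2, R < ‖x‖ → f (hypPt s x) = 0) {B : ℝ}
    (h : L2Le (fun x => (hypPt s x).1⁻¹ • f (hypPt s x)) B)
    (h0 : L2Le (fun x => (hypPt s x).1⁻¹ • boost 0 f (hypPt s x)) B)
    (h1 : L2Le (fun x => (hypPt s x).1⁻¹ • boost 1 f (hypPt s x)) B)
    (h01 : L2Le (fun x => (hypPt s x).1⁻¹ • boost 0 (boost 1 f) (hypPt s x)) B) (x : Space2) :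
    ‖f (hypPt s x)‖ ≤ 3 * B := by
  have key := norm_sq_le_integral_boost hs hU hsU hf hR x
  have hB := h.nonneg
  have hle : ‖f (hypPt s x)‖ ^ 2 ≤ 2 * B ^ 2 + B ^ 2 + 2 * B ^ 2 + B ^ 2 := by
    refine key.trans ?_
    have I0 := h.integrable_sq.const_mul 2
    have I1 := h1.integrable_sq.const_mul 2
    have I2 : Integrable fun y => 2 * ‖(hypPt s y).1⁻¹ • f (hypPt s y)‖ ^ 2
        + ‖(hypPt s y).1⁻¹ • boost 0 f (hypPt s y)‖ ^ 2 := I0.add h0.integrable_sq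
    have I3 : Integrable fun y => 2 * ‖(hypPt s y).1⁻¹ • f (hypPt s y)‖ ^ 2
        + ‖(hypPt s y).1⁻¹ • boost 0 f (hypPt s y)‖ ^ 2
        + 2 * ‖(hypPt s y).1⁻¹ • boost 1 f (hypPt s y)‖ ^ 2 := I2.add I1
    have e : ∫ y, (2 * ‖(hypPt s y).1⁻¹ • f (hypPt s y)‖ ^ 2
        + ‖(hypPt s y).1⁻¹ • boost 0 f (hypPt s y)‖ ^ 2
        + 2 * ‖(hypPt s y).1⁻¹ • boost 1 f (hypPt s y)‖ ^ 2
        + ‖(hypPt s y).1⁻¹ • boost 0 (boost 1 f) (hypPt s y)‖ ^ 2) ≤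
        2 * B ^ 2 + B ^ 2 + 2 * B ^ 2 + B ^ 2 := by
      rw [integral_add I3 h01.integrable_sq, integral_add I2 I1, integral_add I0 h0.integrable_sq,
        integral_const_mul, integral_const_mul]
      have := h.integral_sq_le
      have := h0.integral_sq_le
      have := h1.integral_sq_le
      have := h01.integral_sq_le
      linarith
    refine le_trans (integral_mono_of_nonneg (Filter.Eventually.of_forall fun y => ?_)
      (I3.add h01.integrable_sq)
      (Filter.Eventually.of_forall fun y => ?_)) e
    · simp only [Pi.zero_apply]
      positivity
    · simp only [Pi.add_apply, norm_smul, norm_inv, Real.norm_eq_abs,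
        abs_of_pos (hypPt_fst_pos hs y)]
      have hy := abs_coord_div_le hs y 0
      set u := f (hypPt s y)
      set u0 := boost 0 f (hypPt s y)
      set u1 := boost 1 f (hypPt s y)
      set u01 := boost 0 (boost 1 f) (hypPt s y)
      have i1 : |inner ℝ u0 u1| ≤ ‖u0‖ * ‖u1‖ := abs_real_inner_le_norm _ _
      have i2 : |inner ℝ u u01| ≤ ‖u‖ * ‖u01‖ := abs_real_inner_le_norm _ _
      have i3 : |y 0 / (hypPt s y).1 * inner ℝ u u1| ≤ ‖u‖ * ‖u1‖ := by
        rw [abs_mul]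
        have := abs_real_inner_le_norm u u1
        nlinarith [abs_nonneg (y 0 / (hypPt s y).1), abs_nonneg (inner ℝ u u1)]
      have i4 : |2 * inner ℝ u0 u1 + 2 * inner ℝ u u01
          - y 0 / (hypPt s y).1 * (2 * inner ℝ u u1)| ≤
          2 * (‖u0‖ * ‖u1‖) + 2 * (‖u‖ * ‖u01‖) + 2 * (‖u‖ * ‖u1‖) := by
        rw [abs_le] at i1 i2 i3 ⊢
        constructor <;> nlinarith
      calc _ ≤ ((hypPt s y).1⁻¹) ^ 2 *
            (2 * (‖u0‖ * ‖u1‖) + 2 * (‖u‖ * ‖u01‖) + 2 * (‖u‖ * ‖u1‖)) := by gcongr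
        _ ≤ ((hypPt s y).1⁻¹) ^ 2 *
            (2 * ‖u‖ ^ 2 + ‖u0‖ ^ 2 + 2 * ‖u1‖ ^ 2 + ‖u01‖ ^ 2) := by
          refine mul_le_mul_of_nonneg_left ?_ (by positivity)
          -- Cauchy's inequality on each product; the coefficients add up to 6, and `6B² ≤ (3B)²`
          -- gives the final constant.
          nlinarith [sq_nonneg (‖u0‖ - ‖u1‖), sq_nonneg (‖u‖ - ‖u01‖), sq_nonneg (‖u‖ - ‖u1‖)]
        _ = _ := by ring
  refine (le_abs_self _).trans (abs_le_of_sq_le_sq (b := 3 * B) ?_ (by positivity))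
  nlinarith [sq_nonneg B]

variable {T : Fin 2 → E →L[ℝ] E} {φ : Spacetime → E} {k : ℕ} {c : ℝ}

/-- Supplies the compact support on each `H_s` that the energy and Sobolev lemmas need; the radius
`s²` is not sharp. -/
theorem Gen.vanish {s₁ : EReal} (hU : IsOpen U) (hRU : hypRegion s₁ ⊆ U) (hs : 2 ≤ s)
    (hs₁ : (s : EReal) < s₁) (h : Gen T U φ k c f) (hφ : ContDiffOn ℝ (k : WithTop ℕ∞) φ U)
    (h0 : ∀ p ∈ hypRegion s₁, p ∉ coneK → φ p = 0) (x : Space2) (hx : s ^ 2 < ‖x‖) :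
    f (hypPt s x) = 0 :=
  h.eqOn_zero hU (Set.sdiff_subset.trans hRU) (hypRegion_diff_coneK_subset s₁) hφ
    (fun p hp => h0 p hp.1 hp.2) _ ⟨hypPt_mem_hypRegion hs hs₁ x, hypPt_notMem_coneK hx⟩

/-- Weighted `L²` bounds for the generators extend to their combinations. -/
theorem Gen.l2Le (hsU : ∀ x, hypPt s x ∈ U) {ω : Space2 → ℝ} {B : ℝ} {n : ℕ}
    (hbase : ∀ I J, I.length + J.length ≤ n →
      L2Le (fun x => ω x • opIter T I J φ (hypPt s x)) B)
    (h : Gen T U φ k c f) (hk : k ≤ n) : L2Le (fun x => ω x • f (hypPt s x)) (c * B) := by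
  induction h with
  | base I J k hk' => simpa using hbase I J (hk'.trans hk)
  | add _ _ h1 h2 => simpa only [smul_add, add_mul] using (h1 hk).add (h2 hk)
  | @map k c f A _ h =>
    have h1 := h hk
    have := h1.of_norm_le_mul (norm_nonneg A) (A.continuous.comp_aestronglyMeasurable h1.aesm)
      fun x => A.le_opNorm _
    simpa only [map_smul, mul_assoc] using this
  | congr _ he h => simpa only [he (hsU _)] using h hk
  | mono hg hk' hc h =>
    refine (h (hk'.trans hk)).mono (mul_le_mul_of_nonneg_right hc ?_)
    exact (hbase [] [] (by simp)).nonneg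

/-- Pointwise Klainerman-Sobolev bound for fields whose `(s/t)`-weighted norms are controlled. -/
theorem gen_sup_le_of_weighted {E : Type*} [NormedAddCommGroup E] [InnerProductSpace ℝ E]
    {T : Fin 2 → E →L[ℝ] E} {φ f : Spacetime → E} (hs : 0 < s) (hU : IsOpen U)
    (hsU : ∀ x, hypPt s x ∈ U) (hT : ∀ a, ‖T a‖ ≤ 1)
    (hφ : ContDiffOn ℝ ((k + 2 : ℕ) : WithTop ℕ∞) φ U) {B : ℝ}
    (hL : ∀ I J, I.length + J.length ≤ k + 2 →
      L2Le (fun x => (s / (hypPt s x).1) • opIter T I J φ (hypPt s x)) B)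
    (h : Gen T U φ k c f) {R : ℝ} (hR : ∀ x : Space2, R < ‖x‖ → f (hypPt s x) = 0)
    (x : Space2) :
    s * ‖f (hypPt s x)‖ ≤ 12 * (k + 1) * (k + 2) * c * B := by
  have hc := h.nonneg
  have hB : 0 ≤ B := (hL [] [] (by simp)).nonneg
  have hk : (0 : ℝ) ≤ k := by positivity
  have hb (a : Fin 2) := h.boost hU hT a (hφ.of_le (by norm_cast; omega))
  have hbb := (hb 1).boost hU hT 0 hφ
  -- The Sobolev weight is `t⁻¹ = s⁻¹(s/t)`, which is where the gain of `s⁻¹` comes from. Two boosts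
  -- cost `2(k + 1) · 2(k + 2)`.
  have step {g : Spacetime → E} {j d} (hg : Gen T U φ j d g) (hj : j ≤ k + 2)
      (hd : d ≤ 4 * (k + 1) * (k + 2) * c) :
      L2Le (fun x => (hypPt s x).1⁻¹ • g (hypPt s x)) (s⁻¹ * (4 * (k + 1) * (k + 2) * c * B)) := by
    have h1 := (hg.l2Le hsU hL hj).const_smul s⁻¹
    rw [abs_of_pos (by positivity)] at h1
    refine L2Le.mono ?_ (mul_le_mul_of_nonneg_left (mul_le_mul_of_nonneg_right hd hB)
      (by positivity))
    convert h1 using 2 with x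
    rw [smul_smul]
    congr 1
    field_simp
  have h3 := norm_le_of_L2Le_boost hs hU hsU (h.contDiffOn hU (n := 2) (by rwa [add_comm])) hR
    (step h (by omega) (by nlinarith [mul_nonneg hk hc, mul_nonneg (mul_nonneg hk hk) hc]))
    (step (hb 0) (by omega) (by nlinarith [mul_nonneg hk hc, mul_nonneg (mul_nonneg hk hk) hc]))
    (step (hb 1) (by omega) (by nlinarith [mul_nonneg hk hc, mul_nonneg (mul_nonneg hk hk) hc]))
    (step hbb (by omega) (by push_cast; apply le_of_eq; ring)) x
  calc s * ‖f (hypPt s x)‖ ≤ s * (3 * (s⁻¹ * (4 * (k + 1) * (k + 2) * c * B))) := by gcongr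
    _ = _ := by field_simp; ring

theorem boost_fst (a : Fin 2) (p : Spacetime) : boost a (fun q => q.1) p = p.2 a := by
  simp [boost, pd_fst, coordDir_zero, coordDir_succ]

/-- Pointwise Klainerman-Sobolev bound with the weight `t`. -/
theorem gen_sup_le_of_unweighted {E : Type*} [NormedAddCommGroup E] [InnerProductSpace ℝ E]
    {T : Fin 2 → E →L[ℝ] E} {φ f : Spacetime → E} (hs : 0 < s) (hU : IsOpen U)
    (hsU : ∀ x, hypPt s x ∈ U) (hT : ∀ a, ‖T a‖ ≤ 1)
    (hφ : ContDiffOn ℝ ((k + 2 : ℕ) : WithTop ℕ∞) φ U) {B : ℝ}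
    (hL : ∀ I J, I.length + J.length ≤ k + 2 → L2Le (fun x => opIter T I J φ (hypPt s x)) B)
    (h : Gen T U φ k c f) {R : ℝ} (hR : ∀ x : Space2, R < ‖x‖ → f (hypPt s x) = 0)
    (x : Space2) :
    (hypPt s x).1 * ‖f (hypPt s x)‖ ≤ 12 * (k + 1) * (k + 3) * c * B := by
  have hc := h.nonneg
  have hB : 0 ≤ B := (hL [] [] (by simp)).nonneg
  have hk : (0 : ℝ) ≤ k := by positivity
  have hcB : 0 ≤ c * B := mul_nonneg hc hB
  have hkcB : 0 ≤ k * (c * B) := mul_nonneg hk hcB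
  have hkkcB : 0 ≤ k * (k * (c * B)) := mul_nonneg hk hkcB
  have hb (a : Fin 2) := h.boost hU hT a (hφ.of_le (by norm_cast; omega))
  have hbb := (hb 1).boost hU hT 0 hφ
  have hL' : ∀ I J, I.length + J.length ≤ k + 2 →
      L2Le (fun x => (fun _ => (1 : ℝ)) x • opIter T I J φ (hypPt s x)) B := by
    simpa only [one_smul] using hL
  have l2 {g : Spacetime → E} {j d} (hg : Gen T U φ j d g) (hj : j ≤ k + 2) :
      L2Le (fun x => g (hypPt s x)) (d * B) := by
    simpa only [one_smul] using hg.l2Le hsU hL' hj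
  have l2c (a : Fin 2) {g : Spacetime → E} {j d} (hg : Gen T U φ j d g) (hj : j ≤ k + 2) :
      L2Le (fun x => (x a / (hypPt s x).1) • g (hypPt s x)) (d * B) := by
    refine (l2 hg hj).of_norm_le
      ((continuous_coord_div hs a).aestronglyMeasurable.smul (l2 hg hj).aesm) fun x => ?_
    rw [norm_smul]
    exact mul_le_of_le_one_left (norm_nonneg _) (abs_coord_div_le hs x a)
  have hf2 := h.contDiffOn hU (n := 2) (by rwa [add_comm])
  have hfd {p} (hp : p ∈ U) : DifferentiableAt ℝ f p :=
    hf2.differentiableAt_of_isOpen hU (n := 1) hp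
  have hbd {p} (hp : p ∈ U) : DifferentiableAt ℝ (boost 1 f) p :=
    (ContDiffOn.boost (n := 1) hU hf2 1).differentiableAt_of_isOpen hU (n := 0) hp
  have hx2 {p : Spacetime} (a : Fin 2) : DifferentiableAt ℝ (fun q : Spacetime => q.2 a) p := by
    fun_prop
  -- Applying the Sobolev inequality to `tf` cancels its weight `t⁻¹`: for instance `t⁻¹L_a(tf) =
  -- (x_a/t)f + L_af`, with bounded coefficients. The extra terms turn `k + 2` into `k + 3` in the
  -- constant.
  set F : Spacetime → E := fun p => p.1 • f p with hF
  have hFc : ContDiffOn ℝ ((2 : ℕ) : WithTop ℕ∞) F U := contDiff_fst.contDiffOn.smul hf2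
  have e1 (a : Fin 2) : Set.EqOn (boost a F) (fun p => p.2 a • f p + p.1 • boost a f p) U := by
    intro p hp
    rw [hF, boost_smul differentiableAt_fst (hfd hp), boost_fst]
  have e2 : Set.EqOn (boost 0 (boost 1 F)) (fun p => p.2 1 • boost 0 f p + p.2 0 • boost 1 f p
      + p.1 • boost 0 (boost 1 f) p) U := by
    intro p hp
    have h0 : boost 0 (fun q => q.2 1) p = 0 := by
      simp [boost, pd_coord, coordDir_zero]
      rw [show (1 : Fin 3) = (0 : Fin 2).succ from rfl, coordDir_succ]
      simp
    rw [(e1 1).boost hU 0 hp, boost_add ((hx2 1).fun_smul (hfd hp))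
      (differentiableAt_fst.fun_smul (hbd hp)), boost_smul (hx2 1) (hfd hp),
      boost_smul differentiableAt_fst (hbd hp), boost_fst, h0]
    simp [add_assoc]
  have inv (x : Space2) : (hypPt s x).1⁻¹ * (hypPt s x).1 = 1 :=
    inv_mul_cancel₀ (hypPt_fst_pos hs x).ne'
  have c2 (a : Fin 2) (x : Space2) : (hypPt s x).1⁻¹ * (hypPt s x).2 a = x a / (hypPt s x).1 := by
    rw [mul_comm, div_eq_mul_inv]
    rfl
  have g0 : L2Le (fun x => (hypPt s x).1⁻¹ • F (hypPt s x)) (4 * (k + 1) * (k + 3) * (c * B)) := by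
    simp only [hF, smul_smul, inv, one_smul]
    exact (l2 h (by omega)).mono (by nlinarith)
  have g1 (a : Fin 2) : L2Le (fun x => (hypPt s x).1⁻¹ • boost a F (hypPt s x))
      (4 * (k + 1) * (k + 3) * (c * B)) := by
    simp only [e1 a (hsU _), smul_add, smul_smul, inv, one_smul, c2]
    exact ((l2c a h (by omega)).add (l2 (hb a) (by omega))).mono (by nlinarith)
  have g2 : L2Le (fun x => (hypPt s x).1⁻¹ • boost 0 (boost 1 F) (hypPt s x))
      (4 * (k + 1) * (k + 3) * (c * B)) := by
    simp only [e2 (hsU _), smul_add, smul_smul, inv, one_smul, c2]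
    refine (((l2c 1 (hb 0) (by omega)).add (l2c 0 (hb 1) (by omega))).add
      (l2 hbb (by omega))).mono ?_
    push_cast
    nlinarith
  have h3 := norm_le_of_L2Le_boost (R := R) hs hU hsU hFc (fun x hx => by simp [hF, hR x hx]) g0 (g1 0)
    (g1 1) g2 x
  simp only [hF, norm_smul, Real.norm_eq_abs, abs_of_pos (hypPt_fst_pos hs x)] at h3
  linarith

end OnHyperboloid
end

noncomputable section

/-! ### Estimates on one hyperboloid under the bootstrap bounds. -/

section Estimates

variable {γ : Fin 3 → Matrix (Fin 2) (Fin 2) ℂ} {N : ℕ} {s₁ : EReal} {U : Set Spacetime}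
  {ψ : Spacetime → Spinor} {v : Spacetime → ℝ} {s δ B : ℝ}

/-- The consequences of the bootstrap bounds on one hyperboloid `H_s`, in terms of `L²` norms. -/
structure HyperboloidBounds (γ : Fin 3 → Matrix (Fin 2) (Fin 2) ℂ) (N : ℕ) (U : Set Spacetime)
    (ψ : Spacetime → Spinor) (v : Spacetime → ℝ) (s B B' : ℝ) : Prop where
  two_le : 2 ≤ s
  isOpen : IsOpen U
  mem : ∀ x, hypPt s x ∈ U
  regular_spinor : ContDiffOn ℝ (N : WithTop ℕ∞) ψ U
  regular_scalar : ContDiffOn ℝ ((N + 1 : ℕ) : WithTop ℕ∞) v U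
  vanish_spinor : ∀ {k c f}, k ≤ N → Gen (spinBoost γ) U ψ k c f →
    ∀ x : Space2, s ^ 2 < ‖x‖ → f (hypPt s x) = 0
  vanish_scalar : ∀ {k c f}, k ≤ N → Gen 0 U v k c f →
    ∀ x : Space2, s ^ 2 < ‖x‖ → f (hypPt s x) = 0
  spinor_low : ∀ I J, I.length + J.length ≤ N - 1 →
    L2Le (fun x => (s / (hypPt s x).1) • opIter (spinBoost γ) I J ψ (hypPt s x)) (2 * B)
  spinor_top : ∀ I J, I.length + J.length ≤ N →
    L2Le (fun x => (s / (hypPt s x).1) • opIter (spinBoost γ) I J ψ (hypPt s x)) (2 * B')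
  scalar_low : ∀ I J, I.length + J.length ≤ N - 1 →
    L2Le (fun x => opIter 0 I J v (hypPt s x)) B
  dirac : ∀ I J, I.length + J.length + 1 ≤ N → ∀ x,
    diracOp γ (opIter (spinBoost γ) I J ψ) (hypPt s x) =
      opIter (spinBoost γ) I J (fun p => v p • ψ p) (hypPt s x)

/-- Support and coercivity turn the energies into `L²` norms. The Dirac equation holds only on the
region, whose boundary `H_2` is included; `eqOn_opIter` nevertheless gives its differentiated form
there. -/
theorem hyperboloidBounds {C₁ ε : ℝ} (hγ : IsDiracMatrices γ) (hN : 1 ≤ N) (hB : 0 ≤ C₁ * ε)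
    (sol : IsDKGSolution γ N s₁ ψ v) (boot : BootstrapBounds γ N s₁ C₁ ε δ ψ v)
    (hs : 2 ≤ s) (hs₁ : (s : EReal) < s₁) :
    ∃ U, HyperboloidBounds γ N U ψ v s (C₁ * ε) (C₁ * ε * s ^ δ) := by
  obtain ⟨U, hU, hRU, hψ, hv⟩ := sol.regular
  have hs0 : 0 < s := by linarith
  have hm (x : Space2) : hypPt s x ∈ U := hRU (hypPt_mem_hypRegion hs hs₁ x)
  have hvψ {k c f} (hk : k ≤ N) (h : Gen (spinBoost γ) U ψ k c f) (x : Space2)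
      (hx : s ^ 2 < ‖x‖) : f (hypPt s x) = 0 :=
    h.vanish hU hRU hs hs₁ (hψ.of_le (by norm_cast)) (fun p hp hK => (sol.support p hp hK).1) x hx
  have hvv {k c f} (hk : k ≤ N + 1) (h : Gen 0 U v k c f) (x : Space2)
      (hx : s ^ 2 < ‖x‖) : f (hypPt s x) = 0 :=
    h.vanish hU hRU hs hs₁ (hv.of_le (by norm_cast)) (fun p hp hK => (sol.support p hp hK).2) x hx
  have hB' : 0 ≤ C₁ * ε * s ^ δ := mul_nonneg hB (Real.rpow_nonneg hs0.le _)
  have hspin {D : ℝ} (hD : 0 ≤ D) (I J) (hIJ : I.length + J.length ≤ N)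
      (hE : Real.sqrt (energyDirac γ s (pdIter I (modBoostIter γ J ψ))) ≤ D) :
      L2Le (fun x => (s / (hypPt s x).1) • opIter (spinBoost γ) I J ψ (hypPt s x)) (2 * D) :=
    L2Le.of_energyDirac hγ hs0 hm
      (ContDiffOn.opIter (n := 0) hU I J (hψ.of_le (by norm_cast; omega))).continuousOn
      (hvψ le_rfl (Gen.base I J N hIJ)) hD hE
  refine ⟨U, hs, hU, hm, hψ, hv, hvψ, fun hk => hvv (by omega), fun I J h => ?_,
    fun I J h => ?_, fun I J h => ?_, fun I J h x => ?_⟩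
  · exact hspin hB I J (by omega) (boot.dirac_low s hs hs₁ I J (by omega))
  · exact hspin hB' I J h (boot.dirac_top s hs hs₁ I J h)
  · have hE := boot.kg_low s hs hs₁ I J (by omega)
    rw [boostIter_eq] at hE
    refine L2Le.of_energyKG hs0 hU hm
      (ContDiffOn.opIter (n := 1) hU I J (hv.of_le (by norm_cast; omega)))
      (hvv (k := N) (by omega) (Gen.base I J N (by omega))) (fun α => ?_) hB hE
    exact hvv le_rfl (Gen.base (α :: I) J (N + 1) (by simp only [List.length_cons]; omega))
  · rw [← opIter_diracOp hγ hU I J (hψ.of_le (by norm_cast)) (hm x)]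
    have hreg : ContDiffOn ℝ ((I.length + J.length : ℕ) : WithTop ℕ∞) (fun p => v p • ψ p) U :=
      (hv.of_le (by norm_cast; omega)).smul (hψ.of_le (by norm_cast; omega))
    exact eqOn_opIter hU hRU (hypRegion_subset_closure_interior s₁) I J
      (ContDiffOn.diracOp hU (hψ.of_le (by norm_cast))) hreg sol.dirac
      (hypPt_mem_hypRegion hs hs₁ x)

namespace HyperboloidBounds

variable {B' : ℝ} {k : ℕ} {c : ℝ}

theorem pos (H : HyperboloidBounds γ N U ψ v s B B') : 0 < s := by linarith [H.two_le]

theorem nonneg (H : HyperboloidBounds γ N U ψ v s B B') : 0 ≤ B :=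
  (H.scalar_low [] [] (by simp)).nonneg

theorem nonneg_top (H : HyperboloidBounds γ N U ψ v s B B') : 0 ≤ B' := by
  linarith [(H.spinor_top [] [] (by simp)).nonneg]

/-- Klainerman-Sobolev costs two derivatives: orders up to `N - 2` are reached with the growing
bound `B'`, and up to `N - 3` with the uniform bound `B`. -/
theorem sup_spinor_top (hγ : IsDiracMatrices γ) (H : HyperboloidBounds γ N U ψ v s B B')
    {f : Spacetime → Spinor} (h : Gen (spinBoost γ) U ψ k c f) (hk : k + 2 ≤ N) (x : Space2) :
    s * ‖f (hypPt s x)‖ ≤ 24 * (N + 1) ^ 2 * c * B' := by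
  have h1 := gen_sup_le_of_weighted H.pos H.isOpen H.mem (norm_spinBoost_le hγ)
    (H.regular_spinor.of_le (by norm_cast)) (fun I J hIJ => H.spinor_top I J (by omega)) h
    (H.vanish_spinor (by omega) h) x
  have hkN : (k : ℝ) + 2 ≤ N := by exact_mod_cast hk
  have h2 : ((k : ℝ) + 1) * (k + 2) ≤ (N + 1) ^ 2 := by
    rw [sq]
    exact mul_le_mul (by linarith) (by linarith) (by positivity) (by positivity)
  have h3 := mul_le_mul_of_nonneg_right h2 (mul_nonneg h.nonneg H.nonneg_top)
  linarith

theorem sup_spinor_low (hγ : IsDiracMatrices γ) (H : HyperboloidBounds γ N U ψ v s B B')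
    {f : Spacetime → Spinor} (h : Gen (spinBoost γ) U ψ k c f) (hk : k + 3 ≤ N) (x : Space2) :
    s * ‖f (hypPt s x)‖ ≤ 24 * (N + 1) ^ 2 * c * B := by
  have h1 := gen_sup_le_of_weighted H.pos H.isOpen H.mem (norm_spinBoost_le hγ)
    (H.regular_spinor.of_le (by norm_cast; omega)) (fun I J hIJ => H.spinor_low I J (by omega)) h
    (H.vanish_spinor (by omega) h) x
  have hkN : (k : ℝ) + 3 ≤ N := by exact_mod_cast hk
  have h2 : ((k : ℝ) + 1) * (k + 2) ≤ (N + 1) ^ 2 := by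
    rw [sq]
    exact mul_le_mul (by linarith) (by linarith) (by positivity) (by positivity)
  have h3 := mul_le_mul_of_nonneg_right h2 (mul_nonneg h.nonneg H.nonneg)
  linarith

/-- The mass term of the energy controls `φ` without the factor `s/t`, so the decay is in `t` and
not merely in `s`. -/
theorem sup_scalar (H : HyperboloidBounds γ N U ψ v s B B')
    {f : Spacetime → ℝ} (h : Gen 0 U v k c f) (hk : k + 3 ≤ N) (x : Space2) :
    (hypPt s x).1 * ‖f (hypPt s x)‖ ≤ 12 * (N + 1) ^ 2 * c * B := by
  have h1 := gen_sup_le_of_unweighted H.pos H.isOpen H.mem (by simp)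
    (H.regular_scalar.of_le (by norm_cast; omega)) (fun I J hIJ => H.scalar_low I J (by omega)) h
    (H.vanish_scalar (by omega) h) x
  have hkN : (k : ℝ) + 3 ≤ N := by exact_mod_cast hk
  have h2 : ((k : ℝ) + 1) * (k + 3) ≤ (N + 1) ^ 2 := by
    rw [sq]
    exact mul_le_mul (by linarith) (by linarith) (by positivity) (by positivity)
  have h3 := mul_le_mul_of_nonneg_right h2 (mul_nonneg h.nonneg H.nonneg)
  linarith

/-- `L²` bound for the nonlinearity. -/
theorem l2Le_product (hγ : IsDiracMatrices γ) (H : HyperboloidBounds γ N U ψ v s B B')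
    (hN : 4 ≤ N) (hB1 : B ≤ 1) {F : Spacetime → Spinor}
    (h : PGen 0 (spinBoost γ) U v ψ k c F) (hk : k + 1 ≤ N) :
    L2Le (fun x => s • F (hypPt s x)) (24 * (N + 1) ^ 2 * c * B) := by
  have hB := H.nonneg
  have hs := H.pos
  induction h with
  | @base k l m c d f g hf hg hm =>
    have hfc : Continuous fun x => f (hypPt s x) :=
      (hf.contDiffOn H.isOpen (n := 0)
        (H.regular_scalar.of_le (by norm_cast; omega))).continuousOn.comp_hypPt hs H.mem
    have hgc : Continuous fun x => g (hypPt s x) :=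
      (hg.contDiffOn H.isOpen (n := 0)
        (H.regular_spinor.of_le (by norm_cast; omega))).continuousOn.comp_hypPt hs H.mem
    have hc : Continuous fun x => s • f (hypPt s x) • g (hypPt s x) :=
      (hfc.smul hgc).const_smul s
    have hc0 := hf.nonneg
    have hd0 := hg.nonneg
    have hcdB : 0 ≤ (N + 1 : ℝ) ^ 2 * (c * d) * B := by positivity
    have hBB : (N + 1 : ℝ) ^ 2 * (c * d) * B * B ≤ (N + 1) ^ 2 * (c * d) * B :=
      mul_le_of_le_one_right hcdB hB1
    -- If `v` carries at most `N - 3` derivatives, it is put in `L^∞` with weight `t`, and `t ·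
    -- (s/t) = s`. Otherwise at most one derivative falls on `ψ`, and `1 ≤ N - 3` because `N ≥ 4`,
    -- so `ψ` goes in `L^∞` with weight `s`. Either way the bound is quadratic in `B`, and `B ≤ 1`
    -- makes it linear.
    by_cases h3 : k + 3 ≤ N
    · have hgL := hg.l2Le H.mem H.spinor_low (by omega)
      refine (hgL.of_norm_le_mul (r := 12 * (N + 1) ^ 2 * c * B) (by positivity)
        hc.aestronglyMeasurable fun x => ?_).mono (by linarith)
      have h4 := H.sup_scalar hf h3 x
      have ht := hypPt_fst_pos hs x
      rw [norm_smul, norm_smul, norm_smul, Real.norm_eq_abs, Real.norm_eq_abs (s / _),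
        abs_of_pos hs, abs_of_pos (by positivity)]
      calc s * (‖f (hypPt s x)‖ * ‖g (hypPt s x)‖) = ((hypPt s x).1 * ‖f (hypPt s x)‖) *
            (s / (hypPt s x).1 * ‖g (hypPt s x)‖) := by field_simp
        _ ≤ _ := by gcongr
    · have hfL : L2Le (fun x => f (hypPt s x)) (c * B) := by
        have := hf.l2Le (ω := fun _ => 1) H.mem
          (by simpa only [one_smul] using H.scalar_low) (by omega)
        simpa only [one_smul] using this
      refine (hfL.of_norm_le_mul (r := 24 * (N + 1) ^ 2 * d * B) (by positivity)
        hc.aestronglyMeasurable fun x => ?_).mono (by linarith)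
      have h4 := H.sup_spinor_low hγ hg (by omega) x
      rw [norm_smul, norm_smul, Real.norm_eq_abs, abs_of_pos hs]
      calc s * (‖f (hypPt s x)‖ * ‖g (hypPt s x)‖) =
            (s * ‖g (hypPt s x)‖) * ‖f (hypPt s x)‖ := by ring
        _ ≤ _ := by gcongr
  | add _ _ h1 h2 =>
    simp only [smul_add]
    exact ((h1 hk).add (h2 hk)).mono (by linarith)
  | congr _ he h => simpa only [he (H.mem _)] using h hk
  | mono _ hk' hc h =>
    refine (h (by omega)).mono ?_
    gcongr

/-- Pointwise bound for the nonlinearity. -/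
theorem sup_product (hγ : IsDiracMatrices γ) (H : HyperboloidBounds γ N U ψ v s B B')
    (hB1 : B ≤ 1) {F : Spacetime → Spinor}
    (h : PGen 0 (spinBoost γ) U v ψ k c F) (hk : k + 3 ≤ N) (x : Space2) :
    (hypPt s x).1 * (s * ‖F (hypPt s x)‖) ≤ 288 * (N + 1) ^ 4 * c * B := by
  have hB := H.nonneg
  have hs := H.pos
  have ht := hypPt_fst_pos hs x
  induction h with
  | @base k l m c d f g hf hg hm =>
    have h1 := H.sup_scalar hf (by omega) x
    have h2 := H.sup_spinor_low hγ hg (by omega) x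
    have hc0 := hf.nonneg
    have hd0 := hg.nonneg
    have hcdB : 0 ≤ 288 * (N + 1 : ℝ) ^ 4 * (c * d) * B := by positivity
    rw [norm_smul]
    calc (hypPt s x).1 * (s * (‖f (hypPt s x)‖ * ‖g (hypPt s x)‖)) =
          ((hypPt s x).1 * ‖f (hypPt s x)‖) * (s * ‖g (hypPt s x)‖) := by ring
      _ ≤ (12 * (N + 1) ^ 2 * c * B) * (24 * (N + 1) ^ 2 * d * B) := by gcongr
      _ = 288 * (N + 1) ^ 4 * (c * d) * B * B := by ring
      _ ≤ _ := mul_le_of_le_one_right hcdB hB1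
  | @add _ _ _ f g _ _ h1 h2 =>
    have := norm_add_le (f (hypPt s x)) (g (hypPt s x))
    have h3 : (hypPt s x).1 * (s * ‖f (hypPt s x) + g (hypPt s x)‖) ≤
        (hypPt s x).1 * (s * (‖f (hypPt s x)‖ + ‖g (hypPt s x)‖)) := by gcongr
    have := h1 hk
    have := h2 hk
    linarith
  | congr _ he h => simpa only [he (H.mem _)] using h hk
  | mono _ hk' hc h =>
    refine (h (by omega)).trans ?_
    gcongr

/-- The constant of the nonlinear estimates. -/
def nonlinConst (N : ℕ) : ℝ := (4 * (N + 1) + 1) ^ N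

theorem nonlinConst_nonneg (N : ℕ) : 0 ≤ nonlinConst N := by
  unfold nonlinConst
  positivity

/-- The constant of the gradient estimates. -/
def gradConst (N : ℕ) : ℝ :=
  4 * (96 * (N + 1) ^ 3 + 288 * (N + 1) ^ 4 * nonlinConst N)

theorem gradConst_nonneg (N : ℕ) : 0 ≤ gradConst N := by
  have := nonlinConst_nonneg N
  unfold gradConst
  positivity

/-- The pointwise inequality times `s/t`: one more boost reaches order `N`, where only `B'` is
available, and the nonlinearity appears with weight exactly `s`. -/
theorem l2Le_grad_base (hγ : IsDiracMatrices γ) (H : HyperboloidBounds γ N U ψ v s B B')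
    (hN : 4 ≤ N) (hB1 : B ≤ 1) (hBB : B ≤ B') (α : Fin 3) (I : List (Fin 3)) (J : List (Fin 2))
    (hIJ : I.length + J.length + 1 ≤ N) :
    L2Le (fun x => coneWeight s (hypPt s x) • pd α (opIter (spinBoost γ) I J ψ) (hypPt s x))
      (gradConst N * B') := by
  have hs := H.pos
  have hB := H.nonneg
  have hB' := H.nonneg_top
  set f := opIter (spinBoost γ) I J ψ with hf
  have hfG : Gen (spinBoost γ) U ψ (I.length + J.length) 1 f := Gen.base I J _ le_rfl
  have hb (a : Fin 2) := (hfG.boost H.isOpen (norm_spinBoost_le hγ) a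
    (H.regular_spinor.of_le (by norm_cast))).l2Le H.mem H.spinor_top hIJ
  have hP : PGen 0 (spinBoost γ) U v ψ (I.length + J.length) (nonlinConst N)
      (opIter (spinBoost γ) I J fun p => v p • ψ p) :=
    PGen.opIter H.isOpen (by simp) (norm_spinBoost_le hγ) I J (by omega)
      (H.regular_scalar.of_le (by norm_cast; omega)) H.regular_spinor
  have hD := H.l2Le_product hγ hN hB1 hP hIJ
  have hsum := ((hb 0).norm.add (hb 1).norm).add hD.norm
  have hpc : Continuous fun x => pd α f (hypPt s x) :=
    ((ContDiffOn.opIter (n := 1) H.isOpen I J (H.regular_spinor.of_le (by norm_cast; omega))).pd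
      H.isOpen (n := 0) α).continuousOn.comp_hypPt hs H.mem
  have hwc : Continuous fun x : Space2 => coneWeight s (hypPt s x) :=
    ((continuous_hypPt_fst hs).sub continuous_norm).mul (continuous_div_hypPt_fst hs)
  have hwpc : Continuous fun x => coneWeight s (hypPt s x) • pd α f (hypPt s x) := hwc.smul hpc
  refine (hsum.of_norm_le_mul (r := 4) (by norm_num) hwpc.aestronglyMeasurable
    fun x => ?_).mono ?_
  · have ht := hypPt_fst_pos hs x
    have htx := norm_lt_hypPt_fst hs x
    have hst : 0 < s / (hypPt s x).1 := by positivity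
    have key := coneDist_mul_norm_pd_le (Φ := f) hγ (p := hypPt s x) htx α
    rw [H.dirac I J hIJ x] at key
    simp only [norm_smul, Real.norm_eq_abs, abs_of_pos hst, abs_of_pos hs]
    have hcw : |coneWeight s (hypPt s x)| = (s / (hypPt s x).1) * ((hypPt s x).1 - ‖x‖) := by
      rw [coneWeight, mul_comm]
      exact abs_of_nonneg (mul_nonneg hst.le (sub_nonneg.2 htx.le))
    rw [hcw, mul_assoc]
    refine le_trans ?_ (mul_le_mul_of_nonneg_left (le_abs_self _) zero_le_four)
    refine (mul_le_mul_of_nonneg_left key hst.le).trans_eq ?_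
    field_simp
  · have hk : ((I.length + J.length : ℕ) : ℝ) + 1 ≤ N := by exact_mod_cast hIJ
    have hk0 : (0 : ℝ) ≤ ((I.length + J.length : ℕ) : ℝ) := by positivity
    have h1 : 2 * (((I.length + J.length : ℕ) : ℝ) + 1) * 1 * (2 * B') ≤
        48 * (N + 1) ^ 3 * B' := by
      have : ((I.length + J.length : ℕ) : ℝ) + 1 ≤ (N + 1) ^ 3 :=
        (by linarith : _ ≤ (N + 1 : ℝ)).trans (le_self_pow₀ (by linarith) (by norm_num))
      nlinarith
    have h2 : 24 * (N + 1) ^ 2 * nonlinConst N * B ≤ 288 * (N + 1) ^ 4 * nonlinConst N * B' := by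
      have := nonlinConst_nonneg N
      have h3 : (N + 1 : ℝ) ^ 2 ≤ (N + 1) ^ 4 :=
        pow_le_pow_right₀ (by linarith) (by norm_num)
      gcongr
      norm_num
    unfold gradConst
    linarith

/-- Here the pointwise inequality is multiplied by `s`. The boosted spinor has order at most `N -
2`, the limit of `sup_spinor_top`; the nonlinearity carries `st`, the weight of `sup_product`. -/
theorem sup_grad_base (hγ : IsDiracMatrices γ) (H : HyperboloidBounds γ N U ψ v s B B')
    (hB1 : B ≤ 1) (hBB : B ≤ B') (α : Fin 3) (I : List (Fin 3)) (J : List (Fin 2))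
    (hIJ : I.length + J.length + 3 ≤ N) (x : Space2) :
    s * (((hypPt s x).1 - ‖x‖) * ‖pd α (opIter (spinBoost γ) I J ψ) (hypPt s x)‖) ≤
      gradConst N * B' := by
  have hs := H.pos
  have hB := H.nonneg
  have hB' := H.nonneg_top
  set f := opIter (spinBoost γ) I J ψ with hf
  have hfG : Gen (spinBoost γ) U ψ (I.length + J.length) 1 f := Gen.base I J _ le_rfl
  have hb (a : Fin 2) := H.sup_spinor_top hγ (hfG.boost H.isOpen (norm_spinBoost_le hγ) a
    (H.regular_spinor.of_le (by norm_cast; omega))) (by omega) x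
  have hP : PGen 0 (spinBoost γ) U v ψ (I.length + J.length) (nonlinConst N)
      (opIter (spinBoost γ) I J fun p => v p • ψ p) :=
    PGen.opIter H.isOpen (by simp) (norm_spinBoost_le hγ) I J (by omega)
      (H.regular_scalar.of_le (by norm_cast; omega)) H.regular_spinor
  have hD := H.sup_product hγ hB1 hP hIJ x
  have key := coneDist_mul_norm_pd_le (Φ := f) hγ (p := hypPt s x) (norm_lt_hypPt_fst hs x) α
  rw [H.dirac I J (by omega) x] at key
  have key' := mul_le_mul_of_nonneg_left key hs.le
  have hk : ((I.length + J.length : ℕ) : ℝ) + 3 ≤ N := by exact_mod_cast hIJ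
  have h1 : 24 * (N + 1) ^ 2 * (2 * (((I.length + J.length : ℕ) : ℝ) + 1) * 1) * B' ≤
      48 * (N + 1) ^ 3 * B' := by
    have h0 : 0 ≤ 48 * (N + 1 : ℝ) ^ 2 * B' := by positivity
    have := mul_le_mul_of_nonneg_left
      (by linarith : ((I.length + J.length : ℕ) : ℝ) + 1 ≤ N + 1) h0
    linarith
  have h2 : 288 * (N + 1) ^ 4 * nonlinConst N * B ≤ 288 * (N + 1) ^ 4 * nonlinConst N * B' := by
    have := nonlinConst_nonneg N
    gcongr
  have h3 := hb 0
  have h4 := hb 1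
  refine key'.trans ?_
  unfold gradConst
  linarith

/-- The estimate passes to combinations with constant coefficients because `∂_α` commutes with
these; this is how `∂^I L^J ψ` is reached. -/
theorem l2Le_grad (hγ : IsDiracMatrices γ) (H : HyperboloidBounds γ N U ψ v s B B')
    (hN : 4 ≤ N) (hB1 : B ≤ 1) (hBB : B ≤ B') (α : Fin 3) {f : Spacetime → Spinor}
    (h : Gen (spinBoost γ) U ψ k c f) (hk : k + 1 ≤ N) :
    L2Le (fun x => coneWeight s (hypPt s x) • pd α f (hypPt s x)) (c * (gradConst N * B')) := by
  have hd {k c g} (hg : Gen (spinBoost γ) U ψ k c g) (hk : k + 1 ≤ N) (x : Space2) :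
      DifferentiableAt ℝ g (hypPt s x) :=
    (hg.contDiffOn H.isOpen (n := 1) (H.regular_spinor.of_le (by norm_cast; omega))
      ).differentiableAt_of_isOpen H.isOpen (n := 0) (H.mem x)
  induction h with
  | base I J k hk' => simpa using H.l2Le_grad_base hγ hN hB1 hBB α I J (by omega)
  | add hf hg h1 h2 =>
    simp only [pd_add (hd hf hk _) (hd hg hk _), smul_add, add_mul]
    exact (h1 hk).add (h2 hk)
  | @map k c f A hf h =>
    have h1 := h hk
    have := h1.of_norm_le_mul (norm_nonneg A) (A.continuous.comp_aestronglyMeasurable h1.aesm)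
      fun x => A.le_opNorm _
    simpa only [pd_clm A (hd hf hk _), map_smul, mul_assoc] using this
  | congr _ he h => simpa only [he.pd H.isOpen α (H.mem _)] using h hk
  | mono hg hk' hc h =>
    refine (h (by omega)).mono (mul_le_mul_of_nonneg_right hc ?_)
    exact mul_nonneg (gradConst_nonneg N) H.nonneg_top

theorem sup_grad (hγ : IsDiracMatrices γ) (H : HyperboloidBounds γ N U ψ v s B B')
    (hB1 : B ≤ 1) (hBB : B ≤ B') (α : Fin 3) {f : Spacetime → Spinor}
    (h : Gen (spinBoost γ) U ψ k c f) (hk : k + 3 ≤ N) (x : Space2) :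
    s * (((hypPt s x).1 - ‖x‖) * ‖pd α f (hypPt s x)‖) ≤ c * (gradConst N * B') := by
  have hd {k c g} (hg : Gen (spinBoost γ) U ψ k c g) (hk : k + 3 ≤ N) :
      DifferentiableAt ℝ g (hypPt s x) :=
    (hg.contDiffOn H.isOpen (n := 1) (H.regular_spinor.of_le (by norm_cast; omega))
      ).differentiableAt_of_isOpen H.isOpen (n := 0) (H.mem x)
  have hs := H.pos
  have htx : 0 ≤ (hypPt s x).1 - ‖x‖ := by linarith [norm_lt_hypPt_fst hs x]
  induction h with
  | base I J k hk' => simpa using H.sup_grad_base hγ hB1 hBB α I J (by omega) x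
  | @add k _ _ f g hf hg h1 h2 =>
    rw [pd_add (hd hf hk) (hd hg hk)]
    have h3 : s * (((hypPt s x).1 - ‖x‖) * ‖pd α f (hypPt s x) + pd α g (hypPt s x)‖) ≤
        s * (((hypPt s x).1 - ‖x‖) * (‖pd α f (hypPt s x)‖ + ‖pd α g (hypPt s x)‖)) := by
      gcongr
      exact norm_add_le _ _
    have := h1 hk
    have := h2 hk
    linarith
  | @map k c f A hf h =>
    rw [pd_clm A (hd hf hk)]
    calc _ ≤ s * (((hypPt s x).1 - ‖x‖) * (‖A‖ * ‖pd α f (hypPt s x)‖)) := by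
          gcongr
          exact A.le_opNorm _
      _ = ‖A‖ * (s * (((hypPt s x).1 - ‖x‖) * ‖pd α f (hypPt s x)‖)) := by ring
      _ ≤ ‖A‖ * (c * (gradConst N * B')) := mul_le_mul_of_nonneg_left (h hk) (norm_nonneg A)
      _ = _ := by ring
  | congr _ he h => simpa only [he.pd H.isOpen α (H.mem _)] using h hk
  | mono hg hk' hc h =>
    refine (h (by omega)).trans (mul_le_mul_of_nonneg_right hc ?_)
    exact mul_nonneg (gradConst_nonneg N) H.nonneg_top

end HyperboloidBounds

end Estimates
end

theorem proposition4p4 (N : ℕ) (hN : 4 ≤ N) :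
    ∃ C : ℝ, 0 < C ∧
      ∀ (γ : Fin 3 → Matrix (Fin 2) (Fin 2) ℂ), IsDiracMatrices γ →
      ∀ (δ C₁ ε : ℝ), 0 < δ → δ ≤ 1 / 10 → 0 < C₁ → 0 < ε → C₁ * ε ≤ 1 →
      ∀ (s₁ : EReal), 2 < s₁ →
      ∀ (ψ : Spacetime → Spinor) (v : Spacetime → ℝ),
        IsDKGSolution γ N s₁ ψ v → BootstrapBounds γ N s₁ C₁ ε δ ψ v →
      ∀ s : ℝ, 2 ≤ s → (s : EReal) < s₁ →
        (∀ (α : Fin 3) (I : List (Fin 3)) (J : List (Fin 2)), I.length + J.length + 1 ≤ N →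
          normL2f s (fun p => coneWeight s p • pd α (pdIter I (boostIter J ψ)) p)
            + normL2f s (fun p => coneWeight s p • pd α (pdIter I (modBoostIter γ J ψ)) p)
            ≤ ENNReal.ofReal (C * (C₁ * ε) * s ^ δ)) ∧
        (∀ (α : Fin 3) (I : List (Fin 3)) (J : List (Fin 2)), I.length + J.length + 3 ≤ N →
          ∀ x : Space2,
            ‖pd α (pdIter I (boostIter J ψ)) (hypPt s x)‖
              + ‖pd α (pdIter I (modBoostIter γ J ψ)) (hypPt s x)‖
              ≤ C * (C₁ * ε) * ((hypPt s x).1 - ‖x‖)⁻¹ * s ^ (-1 + δ)) := by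
  have hg := HyperboloidBounds.gradConst_nonneg N
  -- The power is the cost of rewriting `∂^I L^J ψ` in modified boosts, the inner 1 is for `∂^I L̂^J
  -- ψ` itself, and the last 1 makes the constant positive.
  refine ⟨((2 * (N + 1)) ^ N + 1) * HyperboloidBounds.gradConst N + 1, by positivity, ?_⟩
  intro γ hγ δ C₁ ε hδ _ hC₁ hε hB1 s₁ _ ψ v sol boot s hs hs₁
  have hB : 0 < C₁ * ε := mul_pos hC₁ hε
  have hs0 : 0 < s := by linarith
  have hsδ : 1 ≤ s ^ δ := Real.one_le_rpow (by linarith) hδ.le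
  obtain ⟨U, H⟩ := hyperboloidBounds hγ (by omega) hB.le sol boot hs hs₁
  have hBB : C₁ * ε ≤ C₁ * ε * s ^ δ := le_mul_of_one_le_right hB.le hsδ
  have hB' : 0 < C₁ * ε * s ^ δ := hB.trans_le hBB
  refine ⟨fun α I J hIJ => ?_, fun α I J hIJ x => ?_⟩
  · have h1 := H.l2Le_grad hγ hN hB1 hBB α (Gen.pdIter_boostIter H.isOpen (norm_spinBoost_le hγ)
      I J (by omega) H.regular_spinor) hIJ
    have h2 := H.l2Le_grad_base hγ hN hB1 hBB α I J hIJ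
    refine (add_le_add h1.le h2.le).trans ?_
    rw [← ENNReal.ofReal_add h1.nonneg h2.nonneg]
    refine ENNReal.ofReal_le_ofReal ?_
    linarith
  · have h1 := H.sup_grad hγ hB1 hBB α (Gen.pdIter_boostIter H.isOpen (norm_spinBoost_le hγ)
      I J (by omega) H.regular_spinor) hIJ x
    have h2 := H.sup_grad_base hγ hB1 hBB α I J hIJ x
    have htx : 0 < (hypPt s x).1 - ‖x‖ := by linarith [norm_lt_hypPt_fst hs0 x]
    rw [Real.rpow_add hs0, Real.rpow_neg_one, modBoostIter_eq]
    rw [show ∀ C : ℝ, C * (C₁ * ε) * ((hypPt s x).1 - ‖x‖)⁻¹ * (s⁻¹ * s ^ δ) =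
      C * (C₁ * ε * s ^ δ) / (s * ((hypPt s x).1 - ‖x‖)) from fun C => by field_simp,
      le_div_iff₀ (by positivity)]
    linarith
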